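/- Let $k\ge 1$ be an integer, and let $\mathbb S_k=\mathbb Z^2\times\{0,\dots,k\}$ be the slab, with edges between vertices at Euclidean distance $1$. Let $\pi:\mathbb S_k\to\mathbb Z^2$ be the projection, and let $\mathbf P_p$ be the law of Bernoulli bond percolation on $\mathbb S_k$, in which the edges are independently open with probability $p$ and closed otherwise. For $A,B,S\subset\mathbb S_k$ with $A,B\subset S$, let $A\overset{S}{\longleftrightarrow}B$ be the event that there is a path of open edges from $A$ to $B$ all of whose vertices lie in $S$. Let $\partial S$ be the set of vertices of $S$ that have a neighbour in $\mathbb S_k\setminus S$. Let $\mathcal H$ be the set of continuous, strictly increasing bijections $h:[0,1]\to[0,1]$ (so $h(0)=0$ and $h(1)=1$). **Theorem.** For every $k\ge1$ and $\varepsilon>0$ there exists $\mathsf h_0\in\mathcal H$ such that the following holds. Let $a,b,c,d\in\mathbb Z$ with $b-a\ge5$ and $d-c\ge5$, and let $S=([a,b]\times[c,d])\times\{0,\dots,k\}$, where $[a,b]$ and $[c,d]$ are intervals of integers. Let $A,B,C,D\subset\partial S$ be such that $\pi(A),\pi(B),\pi(C),\pi(D)$ are pairwise disjoint, and such that for every path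 $\gamma$ from $A$ to $B$ in $S$ and every path $\gamma'$ from $C$ to $D$ in $S$ the sets of vertices $\pi(\gamma)$ and $\pi(\gamma')$ intersect. Then for every $p\in[\varepsilon,1-\varepsilon]$, $$\mathbf P_p\big[C\overset{S}{\longleftrightarrow}A\big]\ \ge\ \mathsf h_0\Big(\min\big\{\mathbf P_p[A\overset{S}{\longleftrightarrow}B],\ \mathbf P_p[C\overset{S}{\longleftrightarrow}D]\big\}\Big).$$ -/

import Mathlib

open MeasureTheory ProbabilityTheory unitInterval

/-- The vertex set `ℤ² × {0, …, k}` of the slab of thickness `k`. -/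
abbrev Slab (k : ℕ) : Type := (ℤ × ℤ) × Fin (k + 1)

/-- The nearest-neighbour graph of the slab: two vertices are adjacent when they are at Euclidean
distance `1` from each other. -/
def slabGraph (k : ℕ) : SimpleGraph (Slab k) where
  Adj x y := (x.1.1 - y.1.1) ^ 2 + (x.1.2 - y.1.2) ^ 2 + ((x.2 : ℤ) - (y.2 : ℤ)) ^ 2 = 1
  symm := ⟨fun x y h => by
    have h' : (y.1.1 - x.1.1) ^ 2 + (y.1.2 - x.1.2) ^ 2 + ((y.2 : ℤ) - (x.2 : ℤ)) ^ 2
      = (x.1.1 - y.1.1) ^ 2 + (x.1.2 - y.1.2) ^ 2 + ((x.2 : ℤ) - (y.2 : ℤ)) ^ 2 := by ring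
    exact h'.trans h⟩
  loopless := ⟨fun x h => by simp at h⟩

/-- The projection of the slab onto `ℤ²`. -/
def slabProj {k : ℕ} (x : Slab k) : ℤ × ℤ := x.1

/-- The slab rectangle `([a,b] × [c,d]) × {0, …, k}`. -/
def slabRect (k : ℕ) (a b c d : ℤ) : Set (Slab k) :=
  slabProj ⁻¹' (Set.Icc a b ×ˢ Set.Icc c d)

/-- The vertex boundary of `U`: the vertices of `U` with a neighbour in the slab outside `U`. -/
def vertexBoundary {k : ℕ} (U : Set (Slab k)) : Set (Slab k) :=
  {x ∈ U | ∃ y, (slabGraph k).Adj x y ∧ y ∉ U}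

/-- The walk `w` runs from `A` to `B` through vertices of `S` only. -/
def IsPathFromToIn {k : ℕ} (A B S : Set (Slab k)) {x y : Slab k} (w : (slabGraph k).Walk x y) :
    Prop :=
  x ∈ A ∧ y ∈ B ∧ ∀ v ∈ w.support, v ∈ S

/-- The planar projection of the set of vertices visited by a walk. -/
def projTrace {k : ℕ} {x y : Slab k} (w : (slabGraph k).Walk x y) : Set (ℤ × ℤ) :=
  slabProj '' {v | v ∈ w.support}

/-- Percolation configurations: every edge is open (`true`) or closed (`false`). -/
abbrev Config (k : ℕ) : Type := (slabGraph k).edgeSet → Bool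

/-- The law of Bernoulli bond percolation of density `p`: edges are independently open with
probability `p` and closed with probability `1 - p`. -/
noncomputable def percLaw (k : ℕ) (p : I) : Measure (Config k) :=
  Measure.infinitePi fun _ => bernoulliMeasure true false p

instance (k : ℕ) (p : I) : IsProbabilityMeasure (percLaw k p) := by
  unfold percLaw; infer_instance

/-- All edges of the walk `w` are open in the configuration `ω`. -/
def IsOpenWalk {k : ℕ} (ω : Config k) {x y : Slab k} (w : (slabGraph k).Walk x y) : Prop :=
  ∀ e, ∀ he : e ∈ w.edges, ω ⟨e, w.edges_subset_edgeSet he⟩ = true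

/-- The event that some path of open edges in `S` connects `A` to `B`. -/
def connected {k : ℕ} (A B S : Set (Slab k)) : Set (Config k) :=
  {ω | ∃ (x y : Slab k) (w : (slabGraph k).Walk x y), IsPathFromToIn A B S w ∧ IsOpenWalk ω w}

/-- The probability, as a point of `[0,1]`, that `A` is connected to `B` in `S`. -/
noncomputable def connProb {k : ℕ} (p : I) (A B S : Set (Slab k)) : I :=
  ⟨(percLaw k p).real (connected A B S), measureReal_nonneg, measureReal_le_one⟩

/-- The increasing homeomorphisms of `[0,1]`. -/
def increasingHomeos : Set (I → I) :=
  {h | Continuous h ∧ StrictMono h ∧ Function.Surjective h}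

/-! Only the finite set `O` of open edges of the rectangle matters. The configurations to control
are those in which `A` is joined to `B` but not to `C`. Each is modified in a bounded number of
edges so as to join `A` to `C`, and the result must determine the original up to bounded
multiplicity.

Let γ be the least open path from `A` to `B` in a lexicographic order. A column of γ is a spot if a
path inside it (only its last step may leave the column) joins γ or `A` to the part of the cluster
of `C` lying off the columns of γ, or to a point of `C` in that column. `surgery` opens this bridge
and closes the other edges at its interior vertices. Once γ is known, the column can be read off
from the result, since away from it `A` and `C` are still separated (`surgery_column_unique`). The
path γ stays least if the order ranks the dart entering the bridge after the competing dart of γ. No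
fixed order ensures this at every spot, so the order depends on one bit per dart and one averages
over the bits. Forcing at most two bits keeps γ least and makes the bridge harmless, so at least a
quarter of the bits that make a column a spot are good there (`card_bits_le`). Hence the number of
spots, averaged over bits and configurations, is at most `4 * K` times the probability that `A` is
joined to `C`, where `K = (2 / ε) ^ R` and `R` bounds the number of edges touching a column
(`sum_spots_le`).

Conversely, closing the edges off γ at all spots separates `C` from `D`
(`CrossingGraph.not_conn_pinch`): by the crossing hypothesis the cluster of `C` must enter a column
of γ to reach `D`, and any column it can enter is a spot. This too is reversible. So `C` joined to
`D` forces a spot, and fewer than `t` spots has probability at most `K ^ t` times that of `C` not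
joined to `D`.

With `x`, `y`, `q` the probabilities of the connections `A`-`B`, `C`-`D`, `C`-`A`, positive
association and Markov's inequality give `x * y ≤ (1 + 4 * K) * q` and `x ≤ q + 4 * K / t * q + K ^
t * (1 - y)`. The first keeps `q` away from `0`, the second drives `q` to `1`, and
`exists_increasingHomeo_of_estimates` fits one homeomorphism below both. -/

namespace Gluing

/-! ### Simple paths as lists -/

section Lists

variable {V : Type*}

/-- `l` is an `r`-chain without repetition from `P` to `Q`, only the first vertex of which lies in
`P` and only the last one in `Q`. -/
structure SimplePath (r : V → V → Prop) (P Q : Set V) (l : List V) : Prop where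
  chain : l.IsChain r
  nodup : l.Nodup
  start : ∃ x t, l = x :: t ∧ x ∈ P
  finish : ∃ t x, l = t ++ [x] ∧ x ∈ Q
  start_unique : ∀ a x b, l = a ++ x :: b → x ∈ P → a = []
  finish_unique : ∀ a x b, l = a ++ x :: b → x ∈ Q → b = []

/-- A shortest chain works: a repetition could be cut out, and a later visit to `P` or an earlier
visit to `Q` would allow truncation. -/
theorem exists_simplePath_of_chain {r : V → V → Prop} {P Q : Set V} {l : List V}
    (hc : l.IsChain r) (hs : ∃ x t, l = x :: t ∧ x ∈ P) (he : ∃ t x, l = t ++ [x] ∧ x ∈ Q) :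
    ∃ l, SimplePath r P Q l := by
  classical
  have hex : ∃ n, ∃ l : List V, l.length = n ∧ l.IsChain r ∧ (∃ x t, l = x :: t ∧ x ∈ P) ∧
      (∃ t x, l = t ++ [x] ∧ x ∈ Q) := ⟨_, l, rfl, hc, hs, he⟩
  obtain ⟨m, hm, hc, hs, he⟩ := Nat.find_spec hex
  have hmin : ∀ l' : List V, l'.IsChain r → (∃ x t, l' = x :: t ∧ x ∈ P) →
      (∃ t x, l' = t ++ [x] ∧ x ∈ Q) → m.length ≤ l'.length := fun l' h1 h2 h3 => by
    rw [hm]; exact Nat.find_min' hex ⟨l', rfl, h1, h2, h3⟩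
  refine ⟨m, hc, ?_, hs, he, ?_, ?_⟩
  · by_contra hnd
    rw [← List.exists_duplicate_iff_not_nodup] at hnd
    obtain ⟨x, hx⟩ := hnd
    obtain ⟨a, b, hab, hxb⟩ : ∃ a b, m = a ++ x :: b ∧ x ∈ b := by
      have hx' := List.duplicate_iff_two_le_count.1 hx
      obtain ⟨a, b, hab, hxa⟩ := List.eq_append_cons_of_mem hx.mem
      refine ⟨a, b, hab, ?_⟩
      rw [hab] at hx'
      simp only [List.count_append, List.count_cons_self, List.count_eq_zero_of_not_mem hxa] at hx'
      exact List.count_pos_iff.1 (by omega)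
    obtain ⟨b₁, b₂, rfl⟩ := List.append_of_mem hxb
    have hc' : (a ++ x :: b₂).IsChain r := by
      rw [hab] at hc
      rw [List.isChain_split] at hc ⊢
      refine ⟨hc.1, ?_⟩
      have := hc.2
      rw [← List.cons_append, List.isChain_split] at this
      exact this.2
    have := hmin (a ++ x :: b₂) hc' ?_ ?_
    · rw [hab] at this; simp at this; omega
    · obtain ⟨y, t, hy, hyP⟩ := hs
      rw [hab] at hy
      cases a with
      | nil => exact ⟨x, b₂, rfl, by simp at hy; exact hy.1 ▸ hyP⟩
      | cons z a => exact ⟨z, a ++ x :: b₂, rfl, by simp at hy; exact hy.1 ▸ hyP⟩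
    · obtain ⟨t, y, hy, hyQ⟩ := he
      rw [hab] at hy
      rcases List.eq_nil_or_concat b₂ with rfl | ⟨b₃, w, rfl⟩
      · refine ⟨a, x, by simp, ?_⟩
        have := congrArg List.getLast? hy
        simp [List.getLast?_append, List.getLast?_cons] at this; exact this ▸ hyQ
      · refine ⟨a ++ x :: b₃, w, by simp, ?_⟩
        have := congrArg List.getLast? hy
        simp [List.getLast?_append, List.getLast?_cons] at this; exact this ▸ hyQ
  · rintro a x b rfl hx
    have := hmin (x :: b) (List.isChain_split.1 hc).2 ⟨x, b, rfl, hx⟩ ?_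
    · simp at this; exact this
    · obtain ⟨t, y, hy, hyQ⟩ := he
      rcases List.eq_nil_or_concat b with rfl | ⟨b₃, w, rfl⟩
      · refine ⟨[], x, by simp, ?_⟩
        have := congrArg List.getLast? hy
        simp at this; exact this ▸ hyQ
      · refine ⟨x :: b₃, w, by simp, ?_⟩
        have := congrArg List.getLast? hy
        simp [List.getLast?_append, List.getLast?_cons] at this; exact this ▸ hyQ
  · rintro a x b rfl hx
    have := hmin (a ++ [x]) (List.isChain_split.1 hc).1 ?_ ⟨a, x, rfl, hx⟩
    · simp at this; exact this
    · obtain ⟨y, t, hy, hyP⟩ := hs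
      cases a with
      | nil => exact ⟨x, [], rfl, by simp at hy; exact hy.1 ▸ hyP⟩
      | cons z a => exact ⟨z, a ++ [x], rfl, by simp at hy; exact hy.1 ▸ hyP⟩

theorem exists_simplePath {r : V → V → Prop} {P Q : Set V} {x y : V} (hx : x ∈ P) (hy : y ∈ Q)
    (h : Relation.ReflTransGen r x y) : ∃ l, SimplePath r P Q l := by
  obtain ⟨l, hl, hlast⟩ := List.exists_isChain_cons_of_relationReflTransGen h
  refine exists_simplePath_of_chain hl ⟨x, l, rfl, hx⟩ ⟨(x :: l).dropLast, y, ?_, hy⟩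
  conv_lhs => rw [← List.dropLast_append_getLast (List.cons_ne_nil x l), hlast]

theorem SimplePath.mono {r r' : V → V → Prop} {P Q : Set V} {l : List V} (h : SimplePath r P Q l)
    (hr : l.IsChain r') : SimplePath r' P Q l :=
  ⟨hr, h.nodup, h.start, h.finish, h.start_unique, h.finish_unique⟩

theorem reflTransGen_of_chain {r : V → V → Prop} {a b : List V} {x y : V}
    (h : (x :: a).IsChain r) (hy : x :: a = b ++ [y]) : Relation.ReflTransGen r x y := by
  refine List.relationReflTransGen_of_exists_isChain_cons a h ?_
  simp [hy]

theorem SimplePath.reflTransGen_start {r : V → V → Prop} {P Q : Set V} {l : List V}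
    (h : SimplePath r P Q l) {v : V} (hv : v ∈ l) : ∃ x ∈ P, Relation.ReflTransGen r x v := by
  obtain ⟨a, b, rfl⟩ := List.append_of_mem hv
  obtain ⟨x, t, hx, hxP⟩ := h.start
  refine ⟨x, hxP, ?_⟩
  have hc := (List.isChain_split.1 h.chain).1
  cases a with
  | nil => simp at hx; rw [hx.1]
  | cons z a =>
    simp at hx
    obtain ⟨rfl, -⟩ := hx
    exact reflTransGen_of_chain (b := z :: a) hc (by simp)

/-- Two lists are comparable for the prefix order or split after a common prefix. -/
theorem prefix_or_split (l₁ l₂ : List V) : (∃ t, l₂ = l₁ ++ t) ∨ (∃ t, l₁ = l₂ ++ t) ∨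
    ∃ c g x b y, g ≠ b ∧ l₁ = c ++ g :: x ∧ l₂ = c ++ b :: y := by
  induction l₁ generalizing l₂ with
  | nil => exact Or.inl ⟨l₂, rfl⟩
  | cons u t ih =>
    cases l₂ with
    | nil => exact Or.inr (Or.inl ⟨u :: t, rfl⟩)
    | cons v t' =>
      by_cases huv : u = v
      · subst huv
        rcases ih t' with ⟨s, rfl⟩ | ⟨s, rfl⟩ | ⟨c, g, x, b, y, h, rfl, rfl⟩
        · exact Or.inl ⟨s, rfl⟩
        · exact Or.inr (Or.inl ⟨s, rfl⟩)
        · exact Or.inr (Or.inr ⟨u :: c, g, x, b, y, h, rfl, rfl⟩)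
      · exact Or.inr (Or.inr ⟨[], u, t, v, t', huv, rfl, rfl⟩)

/-- Only the last vertex of a simple path lies in `Q`, so none is a proper prefix of another.
Comparisons of paths are thus always decided at a branching, never by length. -/
theorem SimplePath.eq_or_split {r r' : V → V → Prop} {P Q : Set V} {l₁ l₂ : List V}
    (h₁ : SimplePath r P Q l₁) (h₂ : SimplePath r' P Q l₂) :
    l₁ = l₂ ∨ ∃ c g x b y, g ≠ b ∧ l₁ = c ++ g :: x ∧ l₂ = c ++ b :: y := by
  rcases prefix_or_split l₁ l₂ with ⟨t, rfl⟩ | ⟨t, rfl⟩ | h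
  · obtain ⟨s, x, rfl, hx⟩ := h₁.finish
    have := h₂.finish_unique s x t (by simp) hx
    subst this; simp
  · obtain ⟨s, x, rfl, hx⟩ := h₂.finish
    have := h₁.finish_unique s x t (by simp) hx
    subst this; simp
  · exact Or.inr h

/-- The first link of a list that fails a relation. -/
theorem exists_first_not_rel {r : V → V → Prop} {l : List V} (h : ¬ l.IsChain r) :
    ∃ a u v b, l = a ++ u :: v :: b ∧ (a ++ [u]).IsChain r ∧ ¬ r u v := by
  induction l using List.reverseRecOn with
  | nil => simp at h
  | append_singleton t x ih =>
    by_cases ht : t.IsChain r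
    · rcases List.eq_nil_or_concat t with rfl | ⟨t', u, rfl⟩
      · simp at h
      · refine ⟨t', u, x, [], by simp, by simpa using ht, fun hr => h ?_⟩
        have : (t' ++ u :: x :: []).IsChain r :=
          List.isChain_append_cons_cons.2 ⟨by simpa using ht, hr, by simp⟩
        simpa using this
    · obtain ⟨a, u, v, b, rfl, h1, h2⟩ := ih ht
      exact ⟨a, u, v, b ++ [x], by simp, h1, h2⟩

/-- The first element of a list with a given property. -/
theorem exists_first_mem {p : V → Prop} {l : List V} (h : ∃ x ∈ l, p x) :
    ∃ a x b, l = a ++ x :: b ∧ p x ∧ ∀ y ∈ a, ¬ p y := by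
  induction l with
  | nil => simp at h
  | cons u t ih =>
    by_cases hu : p u
    · exact ⟨[], u, t, rfl, hu, by simp⟩
    · obtain ⟨x, hx, hp⟩ := h
      have : ∃ x ∈ t, p x := by
        rcases List.mem_cons.1 hx with rfl | hx
        · exact absurd hp hu
        · exact ⟨x, hx, hp⟩
      obtain ⟨a, x, b, rfl, hx, ha⟩ := ih this
      exact ⟨u :: a, x, b, rfl, hx, by simpa [hu] using ha⟩

end Lists

/-! ### Lexicographically least paths -/

section Least

variable {V : Type*} [Fintype V]

/-- The rank of a dart: demoted darts come last, ties are broken by the target. -/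
noncomputable def dartKey (s : Option V × V → Bool) (d : Option V × V) : Bool ×ₗ ℕ :=
  toLex (s d, (Fintype.equivFin V d.2 : ℕ))

/-- The ranks of the successive darts of a list entered from `o`. -/
noncomputable def keys (s : Option V × V → Bool) : Option V → List V → List (Bool ×ₗ ℕ)
  | _, [] => []
  | o, v :: t => dartKey s (o, v) :: keys s (some v) t

theorem dartKey_injective (s : Option V × V → Bool) (o : Option V) {u v : V}
    (h : dartKey s (o, u) = dartKey s (o, v)) : u = v := by
  have := congrArg (fun x => (ofLex x).2) h
  simpa [dartKey, Fin.val_inj] using this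

theorem keys_injective (s : Option V × V → Bool) {l₁ l₂ : List V} :
    ∀ o, keys s o l₁ = keys s o l₂ → l₁ = l₂ := by
  induction l₁ generalizing l₂ with
  | nil => intro o h; cases l₂ <;> simp_all [keys]
  | cons u t ih =>
    intro o h
    cases l₂ with
    | nil => simp [keys] at h
    | cons v t' =>
      simp only [keys, List.cons.injEq] at h
      obtain rfl := dartKey_injective s o h.1
      rw [ih _ h.2]

/-- The dart along which a path with prefix `c` enters its next vertex starts here. -/
def source (o : Option V) (c : List V) : Option V := c.getLast?.or o

omit [Fintype V] in
theorem source_cons (o : Option V) (u : V) (c : List V) :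
    source o (u :: c) = source (some u) c := by
  cases c using List.reverseRecOn <;> simp [source, List.getLast?_cons]

/-- Equal prefixes contribute equal ranks, so the order is decided by the two darts leaving the end
of `c`. -/
theorem keys_split_lt {s : Option V × V → Bool} {c : List V} {g b : V} (x y : List V) :
    ∀ o, keys s o (c ++ g :: x) < keys s o (c ++ b :: y) ↔
      keys s (source o c) (g :: x) < keys s (source o c) (b :: y) := by
  induction c with
  | nil => intro o; simp [source]
  | cons u c ih =>
    intro o
    rw [source_cons, ← ih]
    simp only [List.cons_append, keys, List.cons_lt_cons_iff]
    simp

theorem keys_lt_of_dartKey_lt {s : Option V × V → Bool} {c : List V} {g b : V} (x y : List V)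
    {o : Option V} (h : dartKey s (source o c, g) < dartKey s (source o c, b)) :
    keys s o (c ++ g :: x) < keys s o (c ++ b :: y) := by
  rw [keys_split_lt]
  simp only [keys, List.cons_lt_cons_iff]
  exact Or.inl h

theorem dartKey_lt_of_keys_le {s : Option V × V → Bool} {c : List V} {g b : V} {x y : List V}
    {o : Option V} (hgb : g ≠ b) (h : keys s o (c ++ g :: x) ≤ keys s o (c ++ b :: y)) :
    dartKey s (source o c, g) < dartKey s (source o c, b) := by
  rcases lt_trichotomy (dartKey s (source o c, g)) (dartKey s (source o c, b)) with h' | h' | h'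
  · exact h'
  · exact absurd (dartKey_injective s _ h') hgb
  · exact absurd (keys_lt_of_dartKey_lt y x h') (not_lt.2 h)

/-- `γ` is the lexicographically least simple `r`-path from `A` to `B`. -/
def IsLeastPath (s : Option V × V → Bool) (r : V → V → Prop) (A B : Set V) (γ : List V) : Prop :=
  SimplePath r A B γ ∧ ∀ β, SimplePath r A B β → keys s none γ ≤ keys s none β

theorem IsLeastPath.unique {s : Option V × V → Bool} {r : V → V → Prop} {A B : Set V}
    {γ γ' : List V} (h : IsLeastPath s r A B γ) (h' : IsLeastPath s r A B γ') : γ = γ' :=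
  keys_injective s none (le_antisymm (h.2 _ h'.1) (h'.2 _ h.1))

theorem exists_isLeastPath (s : Option V × V → Bool) {r : V → V → Prop} {A B : Set V}
    (h : ∃ l, SimplePath r A B l) : ∃ γ, IsLeastPath s r A B γ := by
  have hfin : {l : List V | SimplePath r A B l}.Finite := by
    refine Set.Finite.subset (List.finite_length_le V (Fintype.card V)) fun l hl => ?_
    exact hl.nodup.length_le_card
  obtain ⟨γ, hγ, hmin⟩ := Set.exists_min_image _ (keys s none) hfin h
  exact ⟨γ, hγ, hmin⟩

/-- Removing edges off the least path only removes competitors. -/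
theorem IsLeastPath.mono {s : Option V × V → Bool} {r r' : V → V → Prop} {A B : Set V}
    {γ : List V} (h : IsLeastPath s r A B γ) (hr : ∀ u v, r' u v → r u v) (hγ : γ.IsChain r') :
    IsLeastPath s r' A B γ :=
  ⟨h.1.mono hγ, fun β hβ => h.2 β (hβ.mono (hβ.chain.imp hr))⟩

/-- The dart `(o, v)` is used by the path `γ` started from the root. -/
def IsDartOf (γ : List V) (d : Option V × V) : Prop :=
  ∃ c x, γ = c ++ d.2 :: x ∧ source none c = d.1

omit [Fintype V] in
theorem source_none_eq_some {c : List V} {u : V} (h : source none c = some u) :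
    ∃ c', c = c' ++ [u] := by
  cases c using List.reverseRecOn with
  | nil => simp [source] at h
  | append_singleton t x => simp [source] at h; exact ⟨t, by rw [h]⟩

omit [Fintype V] in
theorem source_none_eq_none {c : List V} (h : source none c = none) : c = [] := by
  cases c using List.reverseRecOn with
  | nil => rfl
  | append_singleton t x => simp [source] at h

omit [Fintype V] in
theorem append_cons_inj_of_nodup {l a b a' b' : List V} {u : V} (hl : l.Nodup)
    (h : l = a ++ u :: b) (h' : l = a' ++ u :: b') : a = a' ∧ b = b' := by
  subst h
  have h1 : u ∉ a := by
    rw [List.nodup_append] at hl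
    intro hu; exact hl.2.2 u hu u (by simp) rfl
  have h2 : u ∉ a' := by
    rw [h', List.nodup_append] at hl
    intro hu; exact hl.2.2 u hu u (by simp) rfl
  induction a generalizing a' with
  | nil =>
    cases a' with
    | nil => simpa using h'
    | cons z a' => simp at h' h2; exact absurd h'.1 h2.1
  | cons w a ih =>
    cases a' with
    | nil => simp at h' h1; exact absurd h'.1.symm h1.1
    | cons z a' =>
      simp only [List.cons_append, List.cons.injEq] at h'
      have := ih (hl.tail) h'.2 (fun h => h1 (by simp [h])) (fun h => h2 (by simp [h]))
      exact ⟨by rw [h'.1, this.1], this.2⟩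

omit [Fintype V] in
theorem IsDartOf.target_unique {γ : List V} (hγ : γ.Nodup) {o : Option V} {v w : V}
    (hv : IsDartOf γ (o, v)) (hw : IsDartOf γ (o, w)) : v = w := by
  obtain ⟨c, x, h, hc⟩ := hv
  obtain ⟨c', x', h', hc'⟩ := hw
  simp only at h hc h' hc'
  cases o with
  | none =>
    obtain rfl := source_none_eq_none hc
    obtain rfl := source_none_eq_none hc'
    rw [h] at h'; simpa using And.left (by simpa using h')
  | some u =>
    obtain ⟨t, rfl⟩ := source_none_eq_some hc
    obtain ⟨t', rfl⟩ := source_none_eq_some hc'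
    have := (append_cons_inj_of_nodup hγ (a := t) (a' := t') (b := v :: x) (b' := w :: x')
      (by simpa using h) (by simpa using h')).2
    simpa using And.left (by simpa using this)

/-- Demoting darts off a least path and promoting darts of it keeps it least. -/
theorem IsLeastPath.of_bits {s s' : Option V × V → Bool} {r : V → V → Prop} {A B : Set V}
    {γ : List V} (h : IsLeastPath s r A B γ) (hon : ∀ d, IsDartOf γ d → s' d ≤ s d)
    (hoff : ∀ d, ¬ IsDartOf γ d → s d ≤ s' d) : IsLeastPath s' r A B γ := by
  refine ⟨h.1, fun β hβ => ?_⟩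
  rcases h.1.eq_or_split hβ with rfl | ⟨c, g, x, b, y, hgb, hγ, rfl⟩
  · exact le_rfl
  have hle := h.2 _ hβ
  rw [hγ] at hle
  have hlt := dartKey_lt_of_keys_le hgb hle
  have hg : IsDartOf γ (source none c, g) := ⟨c, x, hγ, rfl⟩
  -- A path without repetition has only one dart out of each source, so the competing dart is off
  -- `γ` and can only have been demoted.
  have hb : ¬ IsDartOf γ (source none c, b) := fun hb =>
    hgb (hg.target_unique h.1.nodup hb)
  conv_lhs => rw [hγ]
  refine (keys_lt_of_dartKey_lt x y ?_).le
  have h1 := hon _ hg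
  have h2 := hoff _ hb
  simp only [dartKey, Prod.Lex.toLex_lt_toLex] at hlt ⊢
  rcases hlt with hlt | ⟨heq, hlt⟩
  · exact Or.inl (lt_of_le_of_lt h1 (lt_of_lt_of_le hlt h2))
  · rcases lt_or_eq_of_le (h1.trans (heq.le.trans h2)) with h3 | h3
    · exact Or.inl h3
    · exact Or.inr ⟨h3, hlt⟩

/-- A path which meets a least path either follows it up to the meeting point or leaves it along a
dart of larger rank. -/
theorem IsLeastPath.follow_or_lt {s : Option V × V → Bool} {r : V → V → Prop} {A B : Set V}
    {γ : List V} (h : IsLeastPath s r A B γ) {a : List V} {u : V} (hc : (a ++ [u]).IsChain r)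
    (hnd : (a ++ [u]).Nodup) (hstart : ∃ x t, a ++ [u] = x :: t ∧ x ∈ A)
    (hA : ∀ a' x b', a ++ [u] = a' ++ x :: b' → x ∈ A → a' = [])
    (hB : ∀ x ∈ a ++ [u], x ∉ B) (hu : u ∈ γ) :
    (∃ t, γ = a ++ u :: t) ∨ ∃ c g x b y, γ = c ++ g :: x ∧ a ++ [u] = c ++ b :: y ∧
      dartKey s (source none c, g) < dartKey s (source none c, b) := by
  rcases prefix_or_split γ (a ++ [u]) with ⟨t, ht⟩ | ⟨t, ht⟩ | ⟨c, g, x, b, y, hgb, hγ, hau⟩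
  · obtain ⟨t', w, hw, hwB⟩ := h.1.finish
    exact absurd hwB (hB w (by rw [ht, hw]; simp))
  · exact Or.inl ⟨t, by simpa using ht⟩
  refine Or.inr ⟨c, g, x, b, y, hγ, hau, ?_⟩
  -- Otherwise the path leaves `γ` along a smaller dart and, since it ends at `u ∈ γ`, comes back.
  -- Following it to its first return `w` and then `γ` gives a simple path smaller than `γ`.
  by_contra hlt
  have hlt' : dartKey s (source none c, b) < dartKey s (source none c, g) :=
    lt_of_le_of_ne (not_lt.1 hlt) fun e => hgb (dartKey_injective s _ e).symm
  have hu_by : u ∈ b :: y := by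
    have := congrArg List.getLast? hau
    rcases List.eq_nil_or_concat (b :: y) with h' | ⟨t', w, h'⟩
    · simp at h'
    · rw [h'] at this ⊢
      simp at this
      simp [this]
  have hnd' := hnd
  rw [hau] at hnd'
  have hdisj := (List.nodup_append.1 hnd').2.2
  have hu_gx : u ∈ g :: x := by
    rw [hγ] at hu
    rcases List.mem_append.1 hu with hu | hu
    · exact absurd rfl (hdisj u hu u hu_by)
    · exact hu
  -- Taking the first return is what keeps the spliced path free of repetitions.
  obtain ⟨b₁, w, b₂, hb, hw, hb₁⟩ := exists_first_mem (p := fun v => v ∈ g :: x) ⟨u, hu_by, hu_gx⟩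
  obtain ⟨g₁, g₂, hg⟩ := List.append_of_mem hw
  have hγnd := h.1.nodup
  rw [hγ] at hγnd
  have hγdisj := (List.nodup_append.1 hγnd).2.2
  have hγ' : γ = (c ++ g₁) ++ w :: g₂ := by rw [hγ, hg]; simp
  have hau' : a ++ [u] = (c ++ b₁) ++ w :: b₂ := by rw [hau, hb]; simp
  have hnew : SimplePath r A B ((c ++ b₁) ++ w :: g₂) := by
    refine ⟨?_, ?_, ?_, ?_, ?_, ?_⟩
    · rw [hau'] at hc
      have h1 := h.1.chain
      rw [hγ'] at h1
      exact List.isChain_split.2 ⟨(List.isChain_split.1 hc).1, (List.isChain_split.1 h1).2⟩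
    · have h1 : (c ++ b₁).Nodup := by
        rw [hau'] at hnd; exact (List.nodup_append.1 hnd).1
      have h2 : (w :: g₂).Nodup := by
        have := h.1.nodup
        rw [hγ'] at this; exact (List.nodup_append.1 this).2.1
      refine List.nodup_append.2 ⟨h1, h2, fun p hp q hq hpq => ?_⟩
      subst hpq
      have hpg : p ∈ g :: x := by rw [hg]; exact List.mem_append_right _ hq
      rcases List.mem_append.1 hp with hp | hp
      · exact hγdisj p hp p hpg rfl
      · exact hb₁ p hp hpg
    · obtain ⟨p, t, hp, hpA⟩ := hstart
      rw [hau'] at hp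
      cases hcb : c ++ b₁ with
      | nil => rw [hcb] at hp; exact ⟨w, g₂, rfl, by simp at hp; exact hp.1 ▸ hpA⟩
      | cons q t' => rw [hcb] at hp; exact ⟨q, t' ++ w :: g₂, rfl, by simp at hp; exact hp.1 ▸ hpA⟩
    · obtain ⟨t, p, hp, hpB⟩ := h.1.finish
      rw [hγ'] at hp
      rcases List.eq_nil_or_concat g₂ with h' | ⟨t', q, h'⟩
      · rw [h'] at hp ⊢
        exact ⟨c ++ b₁, w, rfl, by
          have := congrArg List.getLast? hp
          simp at this; exact this ▸ hpB⟩
      · rw [h'] at hp ⊢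
        exact ⟨c ++ b₁ ++ w :: t', q, by simp, by
          have := congrArg List.getLast? hp
          simp [List.getLast?_append, List.getLast?_cons] at this; exact this ▸ hpB⟩
    · intro p z q hpq hz
      rcases List.append_eq_append_iff.1 hpq with ⟨e, he1, he2⟩ | ⟨e, he1, he2⟩
      · cases e with
        | nil =>
          simp at he2
          have := hA p z b₂ (by rw [hau', he2.1]; simp [he1]) hz
          exact this
        | cons e₀ e =>
          simp at he2
          have := h.1.start_unique (c ++ g₁ ++ w :: e) z q (by rw [hγ', he2.2]; simp) hz
          simp at this
      · cases e with
        | nil =>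
          simp at he2
          exact hA p z b₂ (by rw [hau', he2.1, he1]; simp) hz
        | cons e₀ e =>
          simp at he2
          exact hA p z (e ++ w :: b₂) (by rw [hau', he1, he2.1]; simp) hz
    · intro p z q hpq hz
      rcases List.append_eq_append_iff.1 hpq with ⟨e, he1, he2⟩ | ⟨e, he1, he2⟩
      · exact h.1.finish_unique (c ++ g₁ ++ e) z q (by rw [hγ', he2]; simp) hz
      · cases e with
        | nil =>
          simp at he2
          exact h.1.finish_unique (c ++ g₁) z q (by rw [hγ', he2.1, he2.2]) hz
        | cons e₀ e =>
          simp at he2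
          exact absurd hz (hB z (by rw [hau', he1, he2.1]; simp))
  have hle := h.2 _ hnew
  cases b₁ with
  | nil =>
    simp only [List.nil_append, List.cons.injEq] at hb
    rw [hγ, hb.1.symm, List.append_nil] at hle
    exact absurd (keys_lt_of_dartKey_lt g₂ x hlt') (not_lt.2 hle)
  | cons b₀ b₁ =>
    simp only [List.cons_append, List.cons.injEq] at hb
    rw [hγ, ← hb.1, List.append_assoc, List.cons_append] at hle
    exact absurd (keys_lt_of_dartKey_lt (b₁ ++ w :: g₂) x hlt') (not_lt.2 hle)

end Least

/-! ### Bridging a least path and an avoiding cluster -/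

section Bridges

open scoped Classical

set_option linter.unusedSectionVars false

variable {V E Z : Type*} [Fintype V] [Fintype E] (ends : E → Sym2 V) (col : V → Z)

/-- Two vertices are joined by an edge of `O`. -/
def OpenAdj (O : Finset E) (u v : V) : Prop := ∃ e ∈ O, ends e = s(u, v)

/-- Some vertex of `P` is connected to some vertex of `Q` through edges of `O`. -/
def Conn (O : Finset E) (P Q : Set V) : Prop :=
  ∃ x ∈ P, ∃ y ∈ Q, Relation.ReflTransGen (OpenAdj ends O) x y

/-- The columns visited by a list. -/
def cols (γ : List V) : Set Z := {z | ∃ v ∈ γ, col v = z}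

/-- The vertices connected to `C` in `O` off the columns of `γ`. -/
def offReach (C : Set V) (O : Finset E) (γ : List V) : Set V :=
  {y | ∃ c ∈ C, col c ∉ cols col γ ∧ Relation.ReflTransGen
    (fun u v => OpenAdj ends O u v ∧ col u ∉ cols col γ ∧ col v ∉ cols col γ) c y}

/-- The vertices at which a bridge in the column `z` may end. -/
def target (C : Set V) (O : Finset E) (γ : List V) (z : Z) : Set V :=
  {y | y ∈ offReach ends col C O γ ∨ (y ∈ C ∧ col y = z)}

/-- `l` joins `γ` or `A` to the cluster of `C` inside the column `z`. -/
def IsBridge (A C : Set V) (O : Finset E) (γ : List V) (z : Z) (l : List V) : Prop :=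
  SimplePath (fun u v => col u = z ∧ OpenAdj ends Finset.univ u v) ({v | v ∈ γ} ∪ A)
    (target ends col C O γ z) l

/-- The columns of `γ` in which a bridge to the cluster of `C` can be built. -/
noncomputable def spots (A C : Set V) (O : Finset E) (γ : List V) : Finset Z :=
  {z ∈ Finset.univ.image col | z ∈ cols col γ ∧ ∃ l, IsBridge ends col A C O γ z l}

/-- A chosen bridge in the column `z`. -/
noncomputable def bridge (A C : Set V) (O : Finset E) (γ : List V) (z : Z) : List V :=
  if h : ∃ l, IsBridge ends col A C O γ z l then h.choose else []

/-- The edges with an endpoint in the column `z`. -/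
noncomputable def columnEdges (z : Z) : Finset E := {e | ∃ x ∈ ends e, col x = z}

/-- `x` is a vertex of `l` other than its endpoints. -/
def Interior (l : List V) (x : V) : Prop := ∃ a b, a ≠ [] ∧ b ≠ [] ∧ l = a ++ x :: b

/-- `u` and `v` are successive in `l`. -/
def Link (l : List V) (u v : V) : Prop := ∃ a b, l = a ++ u :: v :: b

/-- Open the edges of `l` and close the other edges at its interior vertices. -/
noncomputable def surgery (O : Finset E) (l : List V) : Finset E :=
  {e | (∃ u v, Link l u v ∧ ends e = s(u, v)) ∨ (e ∈ O ∧ ∀ x ∈ ends e, ¬ Interior l x)}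

variable {ends col} {A B C D : Set V} {O O' : Finset E} {γ l : List V} {z : Z}

theorem OpenAdj.symm {u v : V} (h : OpenAdj ends O u v) : OpenAdj ends O v u := by
  obtain ⟨e, he, h⟩ := h
  exact ⟨e, he, by rw [h, Sym2.eq_swap]⟩

theorem reflTransGen_openAdj_symm {u v : V} (h : Relation.ReflTransGen (OpenAdj ends O) u v) :
    Relation.ReflTransGen (OpenAdj ends O) v u := by
  induction h with
  | refl => exact .refl
  | tail _ h ih => exact .head h.symm ih

theorem col_notMem_of_mem_offReach {y : V} (h : y ∈ offReach ends col C O γ) :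
    col y ∉ cols col γ := by
  obtain ⟨c, -, hc, h⟩ := h
  induction h with
  | refl => exact hc
  | tail _ h _ => exact h.2.2

theorem reach_of_mem_offReach {y : V} (h : y ∈ offReach ends col C O γ) :
    ∃ c ∈ C, Relation.ReflTransGen (OpenAdj ends O) c y := by
  obtain ⟨c, hc, -, h⟩ := h
  exact ⟨c, hc, Relation.ReflTransGen.mono (fun _ _ h => h.1) _ _ h⟩

theorem reach_of_mem_target {y : V} (h : y ∈ target ends col C O γ z) :
    ∃ c ∈ C, Relation.ReflTransGen (OpenAdj ends O) c y := by
  rcases h with h | h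
  · exact reach_of_mem_offReach h
  · exact ⟨y, h.1, .refl⟩

/-- The far end of a bridge lies in the cluster of `C`, so a path from `A` in the old configuration
cannot enter the bridge from there. -/
theorem not_reach_of_mem_target (hAC : ¬ Conn ends O A C) {x y : V}
    (hy : y ∈ target ends col C O γ z) (hx : x ∈ A) :
    ¬ Relation.ReflTransGen (OpenAdj ends O) x y := by
  intro h
  obtain ⟨c, hc, h'⟩ := reach_of_mem_target hy
  exact hAC ⟨x, hx, c, hc, h.trans (reflTransGen_openAdj_symm h')⟩

theorem reach_of_mem_path (hγ : SimplePath (OpenAdj ends O) A B γ) {x : V}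
    (hx : x ∈ ({v | v ∈ γ} ∪ A : Set V)) :
    ∃ a ∈ A, Relation.ReflTransGen (OpenAdj ends O) a x := by
  rcases hx with hx | hx
  · exact hγ.reflTransGen_start hx
  · exact ⟨x, hx, .refl⟩

theorem IsBridge.col_of_link (hl : IsBridge ends col A C O γ z l) {u v : V} (h : Link l u v) :
    col u = z := by
  obtain ⟨a, b, h⟩ := h
  exact (List.isChain_iff_forall_rel_of_append_cons_cons.1 hl.chain h).1

theorem IsBridge.adj_of_link (hl : IsBridge ends col A C O γ z l) {u v : V} (h : Link l u v) :
    OpenAdj ends Finset.univ u v := by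
  obtain ⟨a, b, h⟩ := h
  exact (List.isChain_iff_forall_rel_of_append_cons_cons.1 hl.chain h).2

theorem IsBridge.col_of_interior (hl : IsBridge ends col A C O γ z l) {u : V}
    (h : Interior l u) : col u = z := by
  obtain ⟨a, b, -, hb, h⟩ := h
  obtain ⟨v, b, rfl⟩ := List.exists_cons_of_ne_nil hb
  exact hl.col_of_link ⟨a, b, h⟩

theorem IsBridge.notMem_of_interior (hl : IsBridge ends col A C O γ z l) {u : V}
    (h : Interior l u) : u ∉ γ ∧ u ∉ A := by
  obtain ⟨a, b, ha, -, h⟩ := h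
  exact ⟨fun hu => ha (hl.start_unique a u b h (Or.inl hu)),
    fun hu => ha (hl.start_unique a u b h (Or.inr hu))⟩

theorem surgery_sdiff (hl : IsBridge ends col A C O γ z l) :
    surgery ends O l \ columnEdges ends col z = O \ columnEdges ends col z := by
  ext e
  simp only [Finset.mem_sdiff, columnEdges, surgery, Finset.mem_filter, Finset.mem_univ, true_and,
    not_exists, not_and]
  refine and_congr_left fun he => ?_
  constructor
  · rintro (⟨u, v, h, h'⟩ | h)
    · exact absurd (hl.col_of_link h) (he u (by simp [h']))
    · exact h.1
  · exact fun h => Or.inr ⟨h, fun x hx hi => he x hx (hl.col_of_interior hi)⟩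

/-- Every edge of `F` touches a column of `W`, so adjacency off `W` is unaffected. Used both for a
single column and for all the columns of `γ`. -/
theorem openAdj_iff_of_sdiff_eq {W : Set Z} {F : Finset E}
    (hF : ∀ e ∈ F, ∃ x ∈ ends e, col x ∈ W) (h : O' \ F = O \ F) {u v : V} (hu : col u ∉ W)
    (hv : col v ∉ W) : OpenAdj ends O' u v ↔ OpenAdj ends O u v := by
  have key : ∀ e, ends e = s(u, v) → e ∉ F := by
    intro e he heF
    obtain ⟨x, hx, hxW⟩ := hF e heF
    rw [he, Sym2.mem_iff] at hx
    rcases hx with rfl | rfl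
    · exact hu hxW
    · exact hv hxW
  refine exists_congr fun e => and_congr_left fun he => ?_
  have := congrArg (e ∈ ·) h
  simpa [key e he] using this

theorem openAdj_surgery_iff (hl : IsBridge ends col A C O γ z l) {u v : V} (hu : col u ≠ z)
    (hv : col v ≠ z) : OpenAdj ends (surgery ends O l) u v ↔ OpenAdj ends O u v :=
  openAdj_iff_of_sdiff_eq (col := col) (W := {z}) (F := columnEdges ends col z)
    (fun e he => by simpa [columnEdges] using he) (surgery_sdiff hl) hu hv

theorem openAdj_surgery_of_link (hl : IsBridge ends col A C O γ z l) {u v : V}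
    (h : Link l u v) : OpenAdj ends (surgery ends O l) u v := by
  obtain ⟨e, -, he⟩ := hl.adj_of_link h
  exact ⟨e, by simp only [surgery, Finset.mem_filter, Finset.mem_univ, true_and]
               exact Or.inl ⟨u, v, h, he⟩, he⟩

theorem openAdj_surgery_of_not_interior {u v : V}
    (h : OpenAdj ends O u v) (hu : ¬ Interior l u) (hv : ¬ Interior l v) :
    OpenAdj ends (surgery ends O l) u v := by
  obtain ⟨e, he, h⟩ := h
  refine ⟨e, ?_, h⟩
  simp only [surgery, Finset.mem_filter, Finset.mem_univ, true_and]
  refine Or.inr ⟨he, fun x hx => ?_⟩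
  rw [h, Sym2.mem_iff] at hx
  rcases hx with rfl | rfl <;> assumption

theorem link_or_of_openAdj_surgery {u v : V} (h : OpenAdj ends (surgery ends O l) u v) :
    Link l u v ∨ Link l v u ∨ (OpenAdj ends O u v ∧ ¬ Interior l u ∧ ¬ Interior l v) := by
  obtain ⟨e, he, h⟩ := h
  simp only [surgery, Finset.mem_filter, Finset.mem_univ, true_and] at he
  rcases he with ⟨x, y, hxy, he⟩ | ⟨he, hi⟩
  · rw [he, Sym2.eq_iff] at h
    rcases h with ⟨rfl, rfl⟩ | ⟨rfl, rfl⟩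
    · exact Or.inl hxy
    · exact Or.inr (Or.inl hxy)
  · exact Or.inr (Or.inr ⟨⟨e, he, h⟩, hi u (by simp [h]), hi v (by simp [h])⟩)

/-- Interior vertices of a bridge avoid `γ`, so no edge of `γ` is closed. -/
theorem simplePath_surgery (hγ : SimplePath (OpenAdj ends O) A B γ)
    (hl : IsBridge ends col A C O γ z l) : SimplePath (OpenAdj ends (surgery ends O l)) A B γ := by
  refine hγ.mono (List.isChain_iff_forall_rel_of_append_cons_cons.2 fun u v a b h => ?_)
  refine openAdj_surgery_of_not_interior
    (List.isChain_iff_forall_rel_of_append_cons_cons.1 hγ.chain h) ?_ ?_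
  · exact fun hi => (hl.notMem_of_interior hi).1 (by rw [h]; simp)
  · exact fun hi => (hl.notMem_of_interior hi).1 (by rw [h]; simp)

/-- The vertices connected to `C` off the columns of `γ` are insensitive to changes in these
columns. -/
theorem offReach_congr {F : Finset E} (hF : ∀ e ∈ F, ∃ x ∈ ends e, col x ∈ cols col γ)
    (h : O' \ F = O \ F) : offReach ends col C O' γ = offReach ends col C O γ := by
  have : (fun u v => OpenAdj ends O' u v ∧ col u ∉ cols col γ ∧ col v ∉ cols col γ) =
      fun u v => OpenAdj ends O u v ∧ col u ∉ cols col γ ∧ col v ∉ cols col γ := by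
    funext u v
    exact propext (and_congr_left fun huv => openAdj_iff_of_sdiff_eq hF h huv.1 huv.2)
  unfold offReach
  rw [this]

theorem target_congr {F : Finset E} (hF : ∀ e ∈ F, ∃ x ∈ ends e, col x ∈ cols col γ)
    (h : O' \ F = O \ F) (z : Z) : target ends col C O' γ z = target ends col C O γ z := by
  unfold target
  rw [offReach_congr hF h]

theorem exists_mem_of_mem_columnEdges (hz : z ∈ cols col γ) :
    ∀ e ∈ columnEdges ends col z, ∃ x ∈ ends e, col x ∈ cols col γ := by
  intro e he
  simp only [columnEdges, Finset.mem_filter, Finset.mem_univ, true_and] at he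
  obtain ⟨x, hx, rfl⟩ := he
  exact ⟨x, hx, hz⟩

/-- After the surgery, `A` is connected to `C` off the other columns of `γ`. -/
theorem exists_reach_after_surgery (hz : z ∈ cols col γ) (hl : IsBridge ends col A C O γ z l) {O₁ : Finset E}
    (hO : ∀ u v, (col u = z ∨ col u ∉ cols col γ) → (col v = z ∨ col v ∉ cols col γ) →
      OpenAdj ends (surgery ends O l) u v → OpenAdj ends O₁ u v) :
    ∃ x ∈ ({v | v ∈ γ} ∪ A : Set V), ∃ c ∈ C, Relation.ReflTransGen (OpenAdj ends O₁) x c := by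
  obtain ⟨x, t, hx, hxP⟩ := hl.start
  obtain ⟨t', y, hy, hyT⟩ := hl.finish
  refine ⟨x, hxP, ?_⟩
  -- Each step of a bridge starts in the column `z`, so only its last vertex can lie elsewhere, and
  -- then it is off the columns of `γ`.
  have hcol : ∀ a v b, l = a ++ v :: b → col v = z ∨ col v ∉ cols col γ := by
    intro a v b h
    cases b with
    | cons w b => exact Or.inl (hl.col_of_link ⟨a, b, h⟩)
    | nil =>
      have : v = y := by
        have := congrArg List.getLast? (h.symm.trans hy)
        simpa using this
      subst this
      rcases hyT with h | h
      · exact Or.inr (col_notMem_of_mem_offReach h)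
      · exact Or.inl h.2
  have hchain : l.IsChain (OpenAdj ends O₁) :=
    List.isChain_iff_forall_rel_of_append_cons_cons.2 fun u v a b h =>
      hO u v (hcol a u (v :: b) h) (hcol (a ++ [u]) v b (by simp [h]))
        (openAdj_surgery_of_link hl ⟨a, b, h⟩)
  have hxy : Relation.ReflTransGen (OpenAdj ends O₁) x y := by
    rw [hx] at hchain hy
    exact reflTransGen_of_chain hchain hy
  rcases hyT with ⟨c, hc, -, h⟩ | h
  · refine ⟨c, hc, hxy.trans (reflTransGen_openAdj_symm (Relation.ReflTransGen.mono (fun u v huv => ?_) _ _ h))⟩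
    refine hO u v (Or.inr huv.2.1) (Or.inr huv.2.2) ((openAdj_surgery_iff hl ?_ ?_).2 huv.1)
    · rintro rfl; exact huv.2.1 hz
    · rintro rfl; exact huv.2.2 hz
  · exact ⟨y, h.1, hxy⟩

theorem conn_surgery (hγ : SimplePath (OpenAdj ends O) A B γ) (hz : z ∈ cols col γ)
    (hl : IsBridge ends col A C O γ z l) : Conn ends (surgery ends O l) A C := by
  obtain ⟨x, hx, c, hc, h⟩ := exists_reach_after_surgery hz hl (fun _ _ _ _ h => h)
  obtain ⟨a, ha, h'⟩ := reach_of_mem_path (simplePath_surgery hγ hl) hx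
  exact ⟨a, ha, c, hc, h'.trans h⟩

/-- The column of the surgery is determined by the path and the resulting configuration. -/
theorem surgery_column_unique {O₁ O₂ : Finset E} {z₁ z₂ : Z} {l₁ l₂ : List V}
    (hAC : ¬ Conn ends O₁ A C) (h₁ : SimplePath (OpenAdj ends O₁) A B γ)
    (hz₁ : z₁ ∈ cols col γ) (hz₂ : z₂ ∈ cols col γ)
    (hl₁ : IsBridge ends col A C O₁ γ z₁ l₁) (hl₂ : IsBridge ends col A C O₂ γ z₂ l₂)
    (h : surgery ends O₁ l₁ = surgery ends O₂ l₂) : z₁ = z₂ := by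
  by_contra hne
  -- The connection made by the second surgery uses only the column `z₂` and vertices off the
  -- columns of `γ`. If `z₁ ≠ z₂`, the first surgery changed nothing there, so `A` was already
  -- joined to `C` in `O₁`.
  obtain ⟨x, hx, c, hc, hr⟩ := exists_reach_after_surgery (O₁ := O₁) hz₂ hl₂ (by
    have aux : ∀ w, (col w = z₂ ∨ col w ∉ cols col γ) → col w ≠ z₁ := by
      rintro w (hw | hw) hw'
      · exact hne (hw'.symm.trans hw)
      · exact hw (hw' ▸ hz₁)
    intro u v hu hv huv
    rw [← h] at huv
    exact (openAdj_surgery_iff hl₁ (aux u hu) (aux v hv)).1 huv)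
  obtain ⟨a, ha, h'⟩ := reach_of_mem_path h₁ hx
  exact hAC ⟨a, ha, c, hc, h'.trans hr⟩

/-- The dart along which a path coming from the root enters the bridge starting with `u`, `v`. -/
noncomputable def entryDart (γ : List V) (u v : V) : Option V × V :=
  if u ∈ γ then (some u, v) else (none, u)

/-- The bits demote the bridge with respect to the path. -/
def GoodBits (s : Option V × V → Bool) (γ l : List V) : Prop :=
  ∀ u v t, l = u :: v :: t → s (entryDart γ u v) = true ∧
    ∀ w, IsDartOf γ ((entryDart γ u v).1, w) → s ((entryDart γ u v).1, w) = false

theorem dartKey_lt_of_bits {s : Option V × V → Bool} {o : Option V} {u v : V}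
    (hu : s (o, u) = false) (hv : s (o, v) = true) : dartKey s (o, u) < dartKey s (o, v) := by
  simp only [dartKey, Prod.Lex.toLex_lt_toLex, hu, hv]
  exact Or.inl (by decide)

/-- The surgery at a demoted bridge does not change the least path. -/
theorem IsLeastPath.after_surgery {s : Option V × V → Bool} (hAC : ¬ Conn ends O A C)
    (h : IsLeastPath s (OpenAdj ends O) A B γ) (hl : IsBridge ends col A C O γ z l)
    (hs : GoodBits s γ l) : IsLeastPath s (OpenAdj ends (surgery ends O l)) A B γ := by
  refine ⟨simplePath_surgery h.1 hl, fun β hβ => ?_⟩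
  by_cases hβO : β.IsChain fun u v => OpenAdj ends O u v ∧ ¬ Interior l u ∧ ¬ Interior l v
  · exact h.2 β (hβ.mono (hβO.imp fun _ _ h => h.1))
  -- The first step `u`, `v` of `β` that is not an old edge avoiding the interior of the bridge must
  -- be a link of the bridge, and the part of `β` before it is an old path.
  obtain ⟨a, u, v, b, hβe, hc, hnot⟩ := exists_first_not_rel hβO
  have hcO : (a ++ [u]).IsChain (OpenAdj ends O) := hc.imp fun _ _ h => h.1
  have huv : Link l u v ∨ Link l v u := by
    rcases link_or_of_openAdj_surgery
      (List.isChain_iff_forall_rel_of_append_cons_cons.1 hβ.chain hβe) with h | h | h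
    · exact Or.inl h
    · exact Or.inr h
    · exact absurd h hnot
  have hreach : ∃ x ∈ A, Relation.ReflTransGen (OpenAdj ends O) x u := by
    obtain ⟨x, t, hx, hxA⟩ := hβ.start
    refine ⟨x, hxA, ?_⟩
    cases a with
    | nil =>
      have : u = x := by simpa using And.left (by simpa using hβe.symm.trans hx)
      rw [this]
    | cons w a =>
      have : w = x := by simpa using And.left (by simpa using hβe.symm.trans hx)
      subst this
      exact reflTransGen_of_chain (b := w :: a) hcO (by simp)
  have hint : ¬ Interior l u := by
    intro hi
    rcases List.eq_nil_or_concat a with rfl | ⟨a, w, rfl⟩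
    · obtain ⟨x, t, hx, hxA⟩ := hβ.start
      have : u = x := by simpa using And.left (by simpa using hβe.symm.trans hx)
      subst this
      exact (hl.notMem_of_interior hi).2 hxA
    · exact (List.isChain_iff_forall_rel_of_append_cons_cons.1 hc
        (show a.concat w ++ [u] = a ++ w :: u :: [] by simp)).2.2 hi
  -- As `u` is not interior, it is an end of the bridge. It cannot be the far one, which `A` does
  -- not reach in `O`, so `β` enters at the start.
  have hshape : ∃ t, l = u :: v :: t := by
    rcases huv with ⟨p, q, hpq⟩ | ⟨p, q, hpq⟩
    · cases p with
      | nil => exact ⟨q, hpq⟩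
      | cons p₀ p => exact absurd ⟨p₀ :: p, v :: q, by simp, by simp, hpq⟩ hint
    · cases q with
      | cons q₀ q => exact absurd ⟨p ++ [v], q₀ :: q, by simp, by simp, by simp [hpq]⟩ hint
      | nil =>
        obtain ⟨t, y, hy, hyT⟩ := hl.finish
        have : u = y := by
          have := congrArg List.getLast? (hpq.symm.trans hy)
          simpa [List.getLast?_append, List.getLast?_cons] using this
        subst this
        obtain ⟨x, hx, hxu⟩ := hreach
        exact absurd hxu (not_reach_of_mem_target hAC hyT hx)
  obtain ⟨t, hlt⟩ := hshape
  obtain ⟨hs₁, hs₂⟩ := hs u v t hlt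
  have huP : u ∈ ({v | v ∈ γ} ∪ A : Set V) := by
    obtain ⟨x, t', hx, hxP⟩ := hl.start
    have : u = x := by simpa using And.left (by simpa using hlt.symm.trans hx)
    exact this ▸ hxP
  obtain ⟨g₀, γ', hγ₀, hg₀⟩ := h.1.start
  by_cases huγ : u ∈ γ
  · have hentry : entryDart γ u v = (some u, v) := by simp [entryDart, huγ]
    rw [hentry] at hs₁ hs₂
    have hβnd := hβ.nodup
    have hβe' : β = (a ++ [u]) ++ v :: b := by simp [hβe]
    rw [hβe'] at hβnd
    have hst : ∃ x t, a ++ [u] = x :: t ∧ x ∈ A := by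
      obtain ⟨x, t, hx, hxA⟩ := hβ.start
      rw [hβe'] at hx
      cases a with
      | nil => exact ⟨u, [], rfl, by simp at hx; exact hx.1 ▸ hxA⟩
      | cons w a => exact ⟨w, a ++ [u], rfl, by simp at hx; exact hx.1 ▸ hxA⟩
    have hsu : ∀ a' x b', a ++ [u] = a' ++ x :: b' → x ∈ A → a' = [] := by
      intro p x q hpq hx
      exact hβ.start_unique p x (q ++ v :: b) (by rw [hβe', hpq]; simp) hx
    have hsB : ∀ x ∈ a ++ [u], x ∉ B := by
      intro x hx hxB
      obtain ⟨p, q, hpq⟩ := List.append_of_mem hx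
      have := hβ.finish_unique p x (q ++ v :: b) (by rw [hβe', hpq]; simp) hxB
      simp at this
    -- Either `β` follows `γ` up to `u` and leaves along the demoted dart while `γ` uses a promoted
    -- one, or it has already left along a larger dart.
    rcases h.follow_or_lt hcO (List.nodup_append.1 hβnd).1 hst hsu hsB huγ with
      ⟨r, hr⟩ | ⟨c, g, x, d, y, hγe, hau, hlt⟩
    · cases r with
      | nil =>
        obtain ⟨t', w, hw, hwB⟩ := h.1.finish
        have : u = w := by
          have := congrArg List.getLast? (hr.symm.trans hw)
          simpa using this
        subst this
        have := hβ.finish_unique a u (v :: b) hβe hwB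
        simp at this
      | cons g r =>
        have hr' : γ = (a ++ [u]) ++ g :: r := by simp [hr]
        have hsrc : source none (a ++ [u]) = some u := by simp [source]
        conv_lhs => rw [hr']
        rw [hβe']
        refine (keys_lt_of_dartKey_lt r b ?_).le
        rw [hsrc]
        exact dartKey_lt_of_bits (hs₂ g ⟨a ++ [u], r, hr', hsrc⟩) hs₁
    · have hβc : β = c ++ d :: (y ++ v :: b) := by rw [hβe', hau]; simp
      conv_lhs => rw [hγe]
      rw [hβc]
      exact (keys_lt_of_dartKey_lt x (y ++ v :: b) hlt).le
  · have huA : u ∈ A := huP.resolve_left huγ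
    -- A bridge starting off `γ` starts in `A`, where `β` can only begin. The entry is then the
    -- demoted dart out of the root.
    have ha : a = [] := hβ.start_unique a u (v :: b) hβe huA
    subst ha
    have hentry : entryDart γ u v = (none, u) := by simp [entryDart, huγ]
    rw [hentry] at hs₁ hs₂
    rw [hγ₀, hβe]
    refine (keys_lt_of_dartKey_lt (c := []) γ' (v :: b) ?_).le
    exact dartKey_lt_of_bits (hs₂ g₀ ⟨[], γ', hγ₀, rfl⟩) hs₁

end Bridges

/-! ### Separating `C` from `D` by closing edges at the spots -/

section Pinching

open scoped Classical

set_option linter.unusedSectionVars false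

variable {V E Z : Type*} [Fintype V] [Fintype E] (ends : E → Sym2 V) (col : V → Z)

/-- Close the edges off `γ` that touch the columns of `W`. -/
noncomputable def pinch (O : Finset E) (γ : List V) (W : Finset Z) : Finset E :=
  {e ∈ O | (∃ x ∈ ends e, col x ∈ W) → ∃ u v, Link γ u v ∧ ends e = s(u, v)}

variable {ends col} {A B C D : Set V} {O O' : Finset E} {γ l : List V} {z : Z}

theorem bridge_spec (hz : z ∈ spots ends col A C O γ) :
    IsBridge ends col A C O γ z (bridge ends col A C O γ z) := by
  simp only [spots, Finset.mem_filter] at hz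
  simp only [bridge, dif_pos hz.2.2]
  exact hz.2.2.choose_spec

theorem mem_cols_of_mem_spots (hz : z ∈ spots ends col A C O γ) : z ∈ cols col γ := by
  simp only [spots, Finset.mem_filter] at hz
  exact hz.2.1

/-- Spots depend on the configuration only through the cluster of `C` off the columns of `γ`. They
can therefore be recovered after pinching. -/
theorem spots_congr {F : Finset E} (hF : ∀ e ∈ F, ∃ x ∈ ends e, col x ∈ cols col γ)
    (h : O' \ F = O \ F) : spots ends col A C O' γ = spots ends col A C O γ := by
  unfold spots IsBridge
  simp only [target_congr hF h]

theorem mem_spots_of_reach {g y : V} (hg : g ∈ γ) (hgz : col g = z)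
    (hy : y ∈ target ends col C O γ z)
    (h : Relation.ReflTransGen (fun u v => col u = z ∧ OpenAdj ends Finset.univ u v) g y) :
    z ∈ spots ends col A C O γ := by
  simp only [spots, Finset.mem_filter, Finset.mem_image, Finset.mem_univ, true_and]
  exact ⟨⟨g, hgz⟩, ⟨g, hg, hgz⟩, exists_simplePath (Or.inl hg) hy h⟩

theorem OpenAdj.mono (hO : O ⊆ O') {u v : V} (h : OpenAdj ends O u v) : OpenAdj ends O' u v := by
  obtain ⟨e, he, h⟩ := h
  exact ⟨e, hO he, h⟩

theorem Link.mem {u v : V} (h : Link γ u v) : u ∈ γ ∧ v ∈ γ := by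
  obtain ⟨a, b, rfl⟩ := h
  simp

/-- At a pinched column only edges of `γ` survive. -/
theorem mem_of_openAdj_pinch {W : Finset Z} {u v : V} (h : OpenAdj ends (pinch ends col O γ W) u v)
    (huv : col u ∈ W ∨ col v ∈ W) : u ∈ γ ∧ v ∈ γ := by
  obtain ⟨e, he, h⟩ := h
  simp only [pinch, Finset.mem_filter] at he
  obtain ⟨x, y, hxy, he'⟩ := he.2 (by
    rcases huv with hu | hv
    · exact ⟨u, by simp [h], hu⟩
    · exact ⟨v, by simp [h], hv⟩)
  rw [h, Sym2.eq_iff] at he'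
  rcases he' with ⟨rfl, rfl⟩ | ⟨rfl, rfl⟩
  · exact hxy.mem
  · exact hxy.mem.symm

theorem chain_pinch {W : Finset Z} (h : γ.IsChain (OpenAdj ends O)) :
    γ.IsChain (OpenAdj ends (pinch ends col O γ W)) := by
  refine List.isChain_iff_forall_rel_of_append_cons_cons.2 fun u v a b hab => ?_
  obtain ⟨e, he, h⟩ := List.isChain_iff_forall_rel_of_append_cons_cons.1 h hab
  exact ⟨e, by simp only [pinch, Finset.mem_filter]; exact ⟨he, fun _ => ⟨u, v, ⟨a, b, hab⟩, h⟩⟩, h⟩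

theorem pinch_subset {W : Finset Z} : pinch ends col O γ W ⊆ O := Finset.filter_subset _ _

theorem pinch_sdiff {W : Finset Z} :
    pinch ends col O γ W \ W.biUnion (columnEdges ends col) =
      O \ W.biUnion (columnEdges ends col) := by
  ext e
  simp only [Finset.mem_sdiff, Finset.mem_biUnion, columnEdges, Finset.mem_filter, Finset.mem_univ,
    true_and, pinch, not_exists, not_and]
  refine and_congr_left fun h => ⟨fun h => h.1, fun he => ⟨he, ?_⟩⟩
  rintro ⟨x, hx, hxW⟩
  exact absurd rfl (h _ hxW x hx)

theorem exists_col_mem_of_mem_biUnion {e : E}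
    (he : e ∈ (spots ends col A C O γ).biUnion (columnEdges ends col)) :
    ∃ x ∈ ends e, col x ∈ cols col γ := by
  obtain ⟨z, hz, he⟩ := Finset.mem_biUnion.1 he
  exact exists_mem_of_mem_columnEdges (mem_cols_of_mem_spots hz) e he

variable (ends col A B C D) in
/-- Columns are connected, and the projections of paths from `A` to `B` and from `C` to `D`
intersect. -/
structure CrossingGraph : Prop where
  column_connected : ∀ u v, col u = col v →
    Relation.ReflTransGen (fun x y => col x = col u ∧ OpenAdj ends Finset.univ x y) u v
  disjoint : Disjoint C D
  crossing : ∀ l : List V, l.IsChain (OpenAdj ends Finset.univ) → (∃ x t, l = x :: t ∧ x ∈ A) →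
    (∃ t x, l = t ++ [x] ∧ x ∈ B) → ∀ c ∈ C, ∀ d ∈ D, col c ∉ cols col l →
    ¬ Relation.ReflTransGen (fun u v => OpenAdj ends Finset.univ u v ∧ col v ∉ cols col l) c d

/-- Closing the edges off `γ` at all spots disconnects `C` from `D`. -/
theorem CrossingGraph.not_conn_pinch (H : CrossingGraph ends col A B C D)
    (hAC : ¬ Conn ends O A C) (hγ : SimplePath (OpenAdj ends O) A B γ) :
    ¬ Conn ends (pinch ends col O γ (spots ends col A C O γ)) C D := by
  rintro ⟨c, hc, d, hd, h⟩
  by_cases hcγ : col c ∈ cols col γ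
  · obtain ⟨g, hg, hgc⟩ := hcγ
    have hspot : col c ∈ spots ends col A C O γ := by
      refine mem_spots_of_reach hg hgc (Or.inr ⟨hc, rfl⟩) ?_
      have := H.column_connected g c hgc
      rwa [hgc] at this
    -- In a pinched column an open edge at `c` would put `c` on `γ`, hence join `A` to `C`. So `c`
    -- is isolated.
    have hstuck : ∀ y, Relation.ReflTransGen
        (OpenAdj ends (pinch ends col O γ (spots ends col A C O γ))) c y → y = c := by
      intro y hy
      induction hy with
      | refl => rfl
      | tail _ hby ih =>
        rw [ih] at hby
        obtain ⟨a, ha, hr⟩ := hγ.reflTransGen_start (mem_of_openAdj_pinch hby (Or.inl hspot)).1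
        exact absurd ⟨a, ha, _, hc, hr⟩ hAC
    exact Set.disjoint_left.1 H.disjoint hc (hstuck d h ▸ hd)
  · have hoff : ∀ y, Relation.ReflTransGen
        (OpenAdj ends (pinch ends col O γ (spots ends col A C O γ))) c y →
        col y ∉ cols col γ ∧ Relation.ReflTransGen
          (fun u v => OpenAdj ends O u v ∧ col u ∉ cols col γ ∧ col v ∉ cols col γ) c y := by
      intro y hy
      induction hy with
      | refl => exact ⟨hcγ, .refl⟩
      | @tail b y _ h ih =>
        have hy : col y ∉ cols col γ := by
          intro hyγ
          obtain ⟨g, hg, hgy⟩ := hyγ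
          have hspot : col y ∈ spots ends col A C O γ := by
            refine mem_spots_of_reach (y := b) hg hgy (Or.inl ⟨c, hc, hcγ, ih.2⟩) ?_
            have := H.column_connected g y hgy
            rw [hgy] at this
            -- The bridge runs inside the column of `y` up to `y` and then steps out to `b`; only
            -- the source of a step has to lie in the column.
            exact this.tail ⟨rfl, (h.mono (Finset.subset_univ _)).symm⟩
          -- The column of `y` is pinched, so the edge from `b` to `y` would have to be on `γ`,
          -- although `b` is off its columns.
          exact ih.1 ⟨b, (mem_of_openAdj_pinch h (Or.inr hspot)).1, rfl⟩
        exact ⟨hy, ih.2.tail ⟨h.mono pinch_subset, ih.1, hy⟩⟩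
    refine H.crossing γ (hγ.chain.imp fun _ _ h => h.mono (Finset.subset_univ _)) hγ.start hγ.finish
      c hc d hd hcγ (Relation.ReflTransGen.mono (fun u v huv => ?_) _ _ (hoff d h).2)
    exact ⟨huv.1.mono (Finset.subset_univ _), huv.2.2⟩

/-- With no spots, pinching changes nothing and cannot disconnect `C` from `D`. -/
theorem CrossingGraph.spots_nonempty (H : CrossingGraph ends col A B C D)
    (hAC : ¬ Conn ends O A C) (hCD : Conn ends O C D) (hγ : SimplePath (OpenAdj ends O) A B γ) :
    (spots ends col A C O γ).Nonempty := by
  rw [Finset.nonempty_iff_ne_empty]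
  intro h
  have := H.not_conn_pinch hAC hγ
  rw [h] at this
  exact this (by simpa [pinch] using hCD)

/-! ### Bits -/

variable (ends A B) in
/-- The least simple path from `A` to `B` in `O`. -/
noncomputable def leastPath (s : Option V × V → Bool) (O : Finset E) : List V :=
  if h : ∃ γ, IsLeastPath s (OpenAdj ends O) A B γ then h.choose else []

theorem leastPath_spec (s : Option V × V → Bool) (h : Conn ends O A B) :
    IsLeastPath s (OpenAdj ends O) A B (leastPath ends A B s O) := by
  obtain ⟨x, hx, y, hy, hr⟩ := h
  have := exists_isLeastPath s (exists_simplePath hx hy hr)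
  simp only [leastPath, dif_pos this]
  exact this.choose_spec

/-- `d` is the dart along which a path from the root enters the bridge `l`. -/
def IsEntry (γ l : List V) (d : Option V × V) : Prop :=
  ∃ u v t, l = u :: v :: t ∧ d = entryDart γ u v

/-- Demote the entry of the bridge and promote the competing dart of the path. -/
noncomputable def adjustBits (γ l : List V) (s : Option V × V → Bool) (d : Option V × V) : Bool :=
  if IsEntry γ l d then true
  else if (∃ e, IsEntry γ l e ∧ d.1 = e.1) ∧ IsDartOf γ d then false else s d

/-- Only the first vertex of a bridge may lie on `γ`, so the bit to raise and the bit to lower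
belong to different darts. -/
theorem IsBridge.not_isDartOf_of_isEntry (hl : IsBridge ends col A C O γ z l)
    {d : Option V × V} (hd : IsEntry γ l d) : ¬ IsDartOf γ d := by
  obtain ⟨u, v, t, h, rfl⟩ := hd
  rintro ⟨c, x, hγ, -⟩
  unfold entryDart at hγ
  split_ifs at hγ with hu
  · have := hl.start_unique [u] v t (by simp [h]) (Or.inl (by rw [hγ]; simp))
    simp at this
  · exact hu (by rw [hγ]; simp)

theorem IsLeastPath.adjustBits {s : Option V × V → Bool} {r : V → V → Prop}
    (h : IsLeastPath s r A B γ) (hl : IsBridge ends col A C O γ z l) :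
    IsLeastPath (adjustBits γ l s) r A B γ := by
  refine h.of_bits (fun d hd => ?_) (fun d hd => ?_)
  · have : ¬ IsEntry γ l d := fun he => hl.not_isDartOf_of_isEntry he hd
    unfold Gluing.adjustBits
    rw [if_neg this]
    split_ifs
    · exact Bool.false_le _
    · exact le_rfl
  · unfold Gluing.adjustBits
    split_ifs with h1 h2
    · exact Bool.le_true _
    · exact absurd h2.2 hd
    · exact le_rfl

theorem goodBits_adjustBits {s : Option V × V → Bool} (hl : IsBridge ends col A C O γ z l) :
    GoodBits (adjustBits γ l s) γ l := by
  intro u v t h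
  have he : IsEntry γ l (entryDart γ u v) := ⟨u, v, t, h, rfl⟩
  refine ⟨by simp [adjustBits, he], fun w hw => ?_⟩
  have : ¬ IsEntry γ l ((entryDart γ u v).1, w) := fun he => hl.not_isDartOf_of_isEntry he hw
  unfold adjustBits
  rw [if_neg this, if_pos ⟨⟨_, he, rfl⟩, hw⟩]

/-- At most two bits are overwritten, that of the entry and that of the competing dart of `γ`. The
hypotheses `h₁` and `h₂` record their old values in a form that makes sense even when a dart is
missing. -/
theorem adjustBits_injective {s₁ s₂ : Option V × V → Bool} (hγ : γ.Nodup)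
    (h : adjustBits γ l s₁ = adjustBits γ l s₂)
    (h₁ : (∃ e, IsEntry γ l e ∧ s₁ e = true) ↔ (∃ e, IsEntry γ l e ∧ s₂ e = true))
    (h₂ : (∃ d, (∃ e, IsEntry γ l e ∧ d.1 = e.1) ∧ IsDartOf γ d ∧ s₁ d = true) ↔
      (∃ d, (∃ e, IsEntry γ l e ∧ d.1 = e.1) ∧ IsDartOf γ d ∧ s₂ d = true)) : s₁ = s₂ := by
  have hentry : ∀ d e, IsEntry γ l d → IsEntry γ l e → d = e := by
    rintro d e ⟨u, v, t, h, rfl⟩ ⟨u', v', t', h', rfl⟩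
    rw [h] at h'
    simp only [List.cons.injEq] at h'
    rw [h'.1, h'.2.1]
  funext d
  rw [Bool.eq_iff_iff]
  by_cases hd : IsEntry γ l d
  · have key : ∀ s : Option V × V → Bool, (∃ e, IsEntry γ l e ∧ s e = true) ↔ s d = true :=
      fun s => ⟨fun ⟨e, he, hs⟩ => hentry e d he hd ▸ hs, fun hs => ⟨d, hd, hs⟩⟩
    rw [← key, ← key, h₁]
  · by_cases hd' : (∃ e, IsEntry γ l e ∧ d.1 = e.1) ∧ IsDartOf γ d
    · have key : ∀ s : Option V × V → Bool,
          (∃ d, (∃ e, IsEntry γ l e ∧ d.1 = e.1) ∧ IsDartOf γ d ∧ s d = true) ↔ s d = true := by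
        refine fun s => ⟨fun ⟨d', ⟨e', he', hde'⟩, hdart, hs⟩ => ?_, fun hs => ⟨d, hd'.1, hd'.2, hs⟩⟩
        obtain ⟨⟨e, he, hde⟩, hdart₂⟩ := hd'
        obtain rfl := hentry e e' he he'
        have h1 : d'.1 = d.1 := hde'.trans hde.symm
        have h2 : d'.2 = d.2 := by
          refine IsDartOf.target_unique hγ (o := d.1) ?_ hdart₂
          rwa [← h1]
        rwa [← Prod.ext h1 h2]
      rw [← key, ← key, h₂]
    · have := congrFun h d
      simp only [adjustBits, if_neg hd, if_neg hd'] at this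
      rw [this]

/-- A positive fraction of the bits demote the bridge at a given spot. -/
theorem card_bits_le (hAB : Conn ends O A B) (z : Z) :
    Finset.card {s : Option V × V → Bool | z ∈ spots ends col A C O (leastPath ends A B s O)} ≤
      4 * Finset.card {s : Option V × V → Bool |
        z ∈ spots ends col A C O (leastPath ends A B s O) ∧
        GoodBits s (leastPath ends A B s O)
          (bridge ends col A C O (leastPath ends A B s O) z)} := by
  set L : (Option V × V → Bool) → List V := fun s => leastPath ends A B s O with hL
  set b : List V → List V := fun γ => bridge ends col A C O γ z with hb
  let Φ : (Option V × V → Bool) → (Option V × V → Bool) := fun s => adjustBits (L s) (b (L s)) s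
  let g₁ : (Option V × V → Bool) → Bool := fun s =>
    decide (∃ e, IsEntry (L s) (b (L s)) e ∧ s e = true)
  let g₂ : (Option V × V → Bool) → Bool := fun s =>
    decide (∃ d, (∃ e, IsEntry (L s) (b (L s)) e ∧ d.1 = e.1) ∧ IsDartOf (L s) d ∧ s d = true)
  -- The adjusted bits have the same least path, so the two overwritten positions can be located
  -- from the image; the factor 4 counts their old values.
  have hΦ : ∀ s, z ∈ spots ends col A C O (L s) → L (Φ s) = L s := fun s hs =>
    (leastPath_spec (Φ s) hAB).unique ((leastPath_spec s hAB).adjustBits (bridge_spec hs))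
  have := Finset.card_le_card_of_injOn
    (s := {s : Option V × V → Bool | z ∈ spots ends col A C O (L s)})
    (t := Finset.product (Finset.univ : Finset (Bool × Bool)) (Finset.univ.filter
      fun s => z ∈ spots ends col A C O (L s) ∧ GoodBits s (L s) (b (L s))))
    (fun s => ((g₁ s, g₂ s), Φ s)) ?_ ?_
  · refine this.trans (le_of_eq ?_)
    exact (Finset.card_product _ _).trans (by simp; rfl)
  · intro s hs
    simp only [Finset.coe_filter, Finset.mem_univ, true_and, Set.mem_ofPred_eq] at hs
    refine Finset.mem_coe.2 (Finset.mem_product.2 ⟨Finset.mem_univ _, Finset.mem_filter.2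
      ⟨Finset.mem_univ _, ?_⟩⟩)
    rw [hΦ s hs]
    exact ⟨hs, goodBits_adjustBits (bridge_spec hs)⟩
  · intro s hs s' hs' h
    simp only [Finset.coe_filter, Finset.mem_univ, true_and, Set.mem_ofPred_eq] at hs hs'
    simp only [Prod.mk.injEq] at h
    obtain ⟨⟨h1, h2⟩, h3⟩ := h
    have hγ : L s = L s' := by rw [← hΦ s hs, ← hΦ s' hs', h3]
    simp only [g₁, g₂, Φ, ← hγ, decide_eq_decide] at h1 h2 h3
    exact adjustBits_injective (leastPath_spec s hAB).1.nodup h3 h1 h2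

end Pinching

/-! ### Weighted sums over configurations -/

section Weights

open scoped Classical

variable {E : Type*} [Fintype E]

/-- The weight of the configuration with set of open edges `O`. -/
noncomputable def weight (p : ℝ) (O : Finset E) : ℝ := ∏ e : E, if e ∈ O then p else 1 - p

theorem weight_nonneg {p : ℝ} (h0 : 0 ≤ p) (h1 : p ≤ 1) (O : Finset E) : 0 ≤ weight p O :=
  Finset.prod_nonneg fun e _ => by split_ifs <;> linarith

/-- Each factor of a weight lies in `[ε, 1]`, so an edge of `F` costs at most `1 / ε`. -/
theorem weight_le {p ε : ℝ} (hε : 0 < ε) (hp : ε ≤ p) (hp' : p ≤ 1 - ε) {O O' F : Finset E}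
    (h : O \ F = O' \ F) {R : ℕ} (hR : F.card ≤ R) : weight p O ≤ (1 / ε) ^ R * weight p O' := by
  have hfac : ∀ e : E, (if e ∈ O then p else 1 - p) ≤
      (if e ∈ F then 1 / ε else 1) * (if e ∈ O' then p else 1 - p) := by
    intro e
    by_cases he : e ∈ F
    · rw [if_pos he]
      have h1 : (if e ∈ O then p else 1 - p) ≤ 1 := by split_ifs <;> linarith
      have h2 : ε ≤ (if e ∈ O' then p else 1 - p) := by split_ifs <;> linarith
      rw [div_mul_eq_mul_div, one_mul]
      exact h1.trans ((one_le_div hε).2 h2)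
    · have : e ∈ O ↔ e ∈ O' := by
        have := congrArg (e ∈ ·) h
        simpa [he] using this
      simp [he, this]
  calc weight p O ≤ ∏ e : E, (if e ∈ F then 1 / ε else 1) * (if e ∈ O' then p else 1 - p) :=
        Finset.prod_le_prod (fun e _ => by split_ifs <;> linarith) fun e _ => hfac e
    _ = (1 / ε) ^ F.card * weight p O' := by
        rw [Finset.prod_mul_distrib, weight]
        congr 1
        rw [Finset.prod_ite_mem]
        simp
    _ ≤ (1 / ε) ^ R * weight p O' := by
        refine mul_le_mul_of_nonneg_right (pow_le_pow_right₀ ?_ hR)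
          (weight_nonneg (by linarith) (by linarith) O')
        rw [one_le_div hε]; linarith

/-- Comparison of weights along a map that changes boundedly many, recoverable edges. -/
theorem sum_weight_le_of_map {ι : Type*} {p ε : ℝ} (hε : 0 < ε) (hp : ε ≤ p) (hp' : p ≤ 1 - ε)
    {X : Finset ι} {Y : Finset (Finset E)} {src tgt F : ι → Finset E} {R : ℕ}
    (hY : ∀ i ∈ X, tgt i ∈ Y) (hR : ∀ i ∈ X, (F i).card ≤ R)
    (hF : ∀ i ∈ X, src i \ F i = tgt i \ F i)
    (hinj : ∀ i ∈ X, ∀ j ∈ X, tgt i = tgt j → F i = F j ∧ (src i = src j → i = j)) :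
    ∑ i ∈ X, weight p (src i) ≤ (2 / ε) ^ R * ∑ O ∈ Y, weight p O := by
  have hfib : ∀ O ∈ Y, ((X.filter fun i => tgt i = O).card : ℝ) ≤ 2 ^ R := by
    intro O _
    rcases (X.filter fun i => tgt i = O).eq_empty_or_nonempty with h | ⟨i₀, hi₀⟩
    · rw [h]; simp
    rw [Finset.mem_filter] at hi₀
    have hle : (X.filter fun i => tgt i = O).card ≤ (F i₀).powerset.card := by
      -- All members of a fibre share the same `F`, off which the source is the target. What remains
      -- is the trace of the source on `F`, with at most `2 ^ R` values.
      refine Finset.card_le_card_of_injOn (fun i => src i ∩ F i₀) (fun i _ => ?_) ?_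
      · simp
      · intro i hi j hj hij
        simp only [Finset.coe_filter, Set.mem_ofPred_eq] at hi hj
        simp only at hij
        have h1 := (hinj i hi.1 i₀ hi₀.1 (hi.2.trans hi₀.2.symm)).1
        have h2 := (hinj j hj.1 i₀ hi₀.1 (hj.2.trans hi₀.2.symm)).1
        refine (hinj i hi.1 j hj.1 (hi.2.trans hj.2.symm)).2 ?_
        have h3 := hF i hi.1
        have h4 := hF j hj.1
        rw [h1, hi.2] at h3
        rw [h2, hj.2] at h4
        rw [← Finset.sdiff_union_inter (src i) (F i₀), ← Finset.sdiff_union_inter (src j) (F i₀),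
          h3, h4, hij]
    rw [Finset.card_powerset] at hle
    calc ((X.filter fun i => tgt i = O).card : ℝ) ≤ ((2 ^ (F i₀).card : ℕ) : ℝ) := by
          exact_mod_cast hle
      _ ≤ 2 ^ R := by
          push_cast
          exact pow_le_pow_right₀ (by norm_num) (hR i₀ hi₀.1)
  calc ∑ i ∈ X, weight p (src i) ≤ ∑ i ∈ X, (1 / ε) ^ R * weight p (tgt i) :=
        Finset.sum_le_sum fun i hi => weight_le hε hp hp' (hF i hi) (hR i hi)
    _ = (1 / ε) ^ R * ∑ i ∈ X, weight p (tgt i) := by rw [Finset.mul_sum]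
    _ = (1 / ε) ^ R * ∑ O ∈ Y, ((X.filter fun i => tgt i = O).card : ℝ) * weight p O := by
        rw [← Finset.sum_fiberwise_of_maps_to hY]
        congr 1
        refine Finset.sum_congr rfl fun O _ => ?_
        rw [Finset.sum_congr rfl (g := fun _ => weight p O)
          (fun i hi => by rw [(Finset.mem_filter.1 hi).2])]
        simp
    _ ≤ (1 / ε) ^ R * ∑ O ∈ Y, 2 ^ R * weight p O := by
        refine mul_le_mul_of_nonneg_left (Finset.sum_le_sum fun O hO => ?_) (by positivity)
        exact mul_le_mul_of_nonneg_right (hfib O hO)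
          (weight_nonneg (by linarith) (by linarith) O)
    _ = (2 / ε) ^ R * ∑ O ∈ Y, weight p O := by
        rw [← Finset.mul_sum, ← mul_assoc, ← mul_pow]
        congr 2
        ring

end Weights

/-! ### The two gluing estimates on a finite graph -/

section Estimates

open scoped Classical

set_option linter.unusedSectionVars false

variable {V E Z : Type*} [Fintype V] [Fintype E] {ends : E → Sym2 V} {col : V → Z}
  {A B C D : Set V} {p ε : ℝ} {R : ℕ}

variable (ends A B C) in
/-- The configurations in which `A` is connected to `B` but not to `C`. -/
noncomputable def separated : Finset (Finset E) := {O | Conn ends O A B ∧ ¬ Conn ends O A C}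

variable (ends A B) in
/-- The configurations in which `A` is connected to `B`. -/
noncomputable def joined : Finset (Finset E) := {O | Conn ends O A B}

variable (ends A B) in
/-- The configurations in which `A` is not connected to `B`. -/
noncomputable def unjoined : Finset (Finset E) := {O | ¬ Conn ends O A B}

/-- The map comparison is applied to pairs (configuration, good spot). The surgered configuration
has the same least path, which determines the column and hence the set of edges that may have
changed. -/
theorem sum_good_spots_le (hε : 0 < ε) (hp : ε ≤ p) (hp' : p ≤ 1 - ε)
    (hR : ∀ z, (columnEdges ends col z).card ≤ R) (s : Option V × V → Bool) :
    ∑ O ∈ separated ends A B C, ∑ z ∈ Finset.univ.image col,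
      (if z ∈ spots ends col A C O (leastPath ends A B s O) ∧ GoodBits s (leastPath ends A B s O)
          (bridge ends col A C O (leastPath ends A B s O) z) then weight p O else 0) ≤
      (2 / ε) ^ R * ∑ O ∈ joined ends A C, weight p O := by
  rw [← Finset.sum_product', ← Finset.sum_filter]
  refine sum_weight_le_of_map hε hp hp' (src := fun i : Finset E × Z => i.1)
    (tgt := fun i => surgery ends i.1 (bridge ends col A C i.1 (leastPath ends A B s i.1) i.2))
    (F := fun i => columnEdges ends col i.2) ?_ (fun i _ => hR i.2) ?_ ?_
  · rintro ⟨O, z⟩ h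
    simp only [Finset.mem_filter, Finset.mem_product, separated, Finset.mem_univ, true_and] at h
    simp only [joined, Finset.mem_filter, Finset.mem_univ, true_and]
    exact conn_surgery (leastPath_spec s h.1.1.1).1 (mem_cols_of_mem_spots h.2.1)
      (bridge_spec h.2.1)
  · rintro ⟨O, z⟩ h
    simp only [Finset.mem_filter] at h
    exact (surgery_sdiff (bridge_spec h.2.1)).symm
  · rintro ⟨O₁, z₁⟩ h₁ ⟨O₂, z₂⟩ h₂ heq
    simp only [Finset.mem_filter, Finset.mem_product, separated, Finset.mem_univ, true_and]
      at h₁ h₂ heq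
    have hl₁ := bridge_spec h₁.2.1
    have hl₂ := bridge_spec h₂.2.1
    have hm₁ := leastPath_spec s h₁.1.1.1
    have hm₂ := leastPath_spec s h₂.1.1.1
    have hn₁ := hm₁.after_surgery h₁.1.1.2 hl₁ h₁.2.2
    have hn₂ := hm₂.after_surgery h₂.1.1.2 hl₂ h₂.2.2
    rw [heq] at hn₁
    have hγ := hn₁.unique hn₂
    have hz₁ := mem_cols_of_mem_spots h₁.2.1
    have hz₂ := mem_cols_of_mem_spots h₂.2.1
    rw [hγ] at hl₁ heq hm₁ hz₁
    have hz : z₁ = z₂ := surgery_column_unique h₁.1.1.2 hm₁.1 hz₁ hz₂ hl₁ hl₂ heq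
    subst hz
    exact ⟨rfl, fun h => by simp only at h; rw [h]⟩

/-- On average over the bits, the total weight of the spots is controlled by the probability that
`A` is connected to `C`. -/
theorem sum_spots_le (hε : 0 < ε) (hp : ε ≤ p) (hp' : p ≤ 1 - ε)
    (hR : ∀ z, (columnEdges ends col z).card ≤ R) :
    ∑ s : Option V × V → Bool, ∑ O ∈ separated ends A B C,
      ((spots ends col A C O (leastPath ends A B s O)).card : ℝ) * weight p O ≤
      Fintype.card (Option V × V → Bool) *
        (4 * (2 / ε) ^ R * ∑ O ∈ joined ends A C, weight p O) := by
  have hcard : ∀ s O, ((spots ends col A C O (leastPath ends A B s O)).card : ℝ) * weight p O =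
      ∑ z ∈ Finset.univ.image col,
        if z ∈ spots ends col A C O (leastPath ends A B s O) then weight p O else 0 := by
    intro s O
    rw [← Finset.sum_filter, Finset.sum_const, nsmul_eq_mul]
    congr 3
    ext z
    simp only [Finset.mem_filter, spots]
    tauto
  have hswap : ∀ (P : (Option V × V → Bool) → Finset E → Z → Prop)
      [∀ s O z, Decidable (P s O z)],
      ∑ s : Option V × V → Bool, ∑ O ∈ separated ends A B C, ∑ z ∈ Finset.univ.image col,
        (if P s O z then weight p O else 0) =
      ∑ O ∈ separated ends A B C, ∑ z ∈ Finset.univ.image col,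
        ((Finset.univ.filter fun s => P s O z).card : ℝ) * weight p O := by
    intro P _
    rw [Finset.sum_comm]
    refine Finset.sum_congr rfl fun O _ => ?_
    rw [Finset.sum_comm]
    refine Finset.sum_congr rfl fun z _ => ?_
    rw [← Finset.sum_filter, Finset.sum_const, nsmul_eq_mul]
  simp only [hcard]
  rw [hswap fun s O z => z ∈ spots ends col A C O (leastPath ends A B s O)]
  calc _ ≤ ∑ O ∈ separated ends A B C, ∑ z ∈ Finset.univ.image col,
        4 * (((Finset.univ.filter fun s : Option V × V → Bool =>
          z ∈ spots ends col A C O (leastPath ends A B s O) ∧ GoodBits s (leastPath ends A B s O)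
          (bridge ends col A C O (leastPath ends A B s O) z)).card : ℝ) * weight p O) := by
        refine Finset.sum_le_sum fun O hO => Finset.sum_le_sum fun z _ => ?_
        simp only [separated, Finset.mem_filter, Finset.mem_univ, true_and] at hO
        rw [← mul_assoc]
        refine mul_le_mul_of_nonneg_right ?_ (weight_nonneg (by linarith) (by linarith) O)
        exact_mod_cast card_bits_le hO.1 z
    _ = 4 * ∑ s : Option V × V → Bool, ∑ O ∈ separated ends A B C, ∑ z ∈ Finset.univ.image col,
      (if z ∈ spots ends col A C O (leastPath ends A B s O) ∧ GoodBits s (leastPath ends A B s O)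
          (bridge ends col A C O (leastPath ends A B s O) z) then weight p O else 0) := by
        rw [hswap fun s O z => z ∈ spots ends col A C O (leastPath ends A B s O) ∧
          GoodBits s (leastPath ends A B s O) (bridge ends col A C O (leastPath ends A B s O) z)]
        simp only [Finset.mul_sum]
    _ ≤ 4 * ∑ s : Option V × V → Bool, (2 / ε) ^ R * ∑ O ∈ joined ends A C, weight p O := by
        refine mul_le_mul_of_nonneg_left (Finset.sum_le_sum fun s _ => ?_) (by norm_num)
        exact sum_good_spots_le hε hp hp' hR s
    _ = _ := by
        rw [Finset.sum_const, Finset.card_univ, nsmul_eq_mul]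
        ring

/-- Configurations with few spots can be disconnected at a bounded cost. -/
theorem sum_few_spots_le (hε : 0 < ε) (hp : ε ≤ p) (hp' : p ≤ 1 - ε)
    (hR : ∀ z, (columnEdges ends col z).card ≤ R) (H : CrossingGraph ends col A B C D)
    (s : Option V × V → Bool) (t : ℕ) :
    ∑ O ∈ (separated ends A B C).filter
      (fun O => (spots ends col A C O (leastPath ends A B s O)).card < t), weight p O ≤
      ((2 / ε) ^ R) ^ t * ∑ O ∈ unjoined ends C D, weight p O := by
  rw [← pow_mul, mul_comm R t]
  refine sum_weight_le_of_map hε hp hp' (src := fun O => O)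
    (tgt := fun O => pinch ends col O (leastPath ends A B s O)
      (spots ends col A C O (leastPath ends A B s O)))
    (F := fun O => (spots ends col A C O (leastPath ends A B s O)).biUnion
      (columnEdges ends col)) ?_ ?_ ?_ ?_
  · intro O h
    simp only [Finset.mem_filter, separated, Finset.mem_univ, true_and] at h
    simp only [unjoined, Finset.mem_filter, Finset.mem_univ, true_and]
    exact H.not_conn_pinch h.1.2 (leastPath_spec s h.1.1).1
  · intro O h
    simp only [Finset.mem_filter] at h
    refine Finset.card_biUnion_le.trans ((Finset.sum_le_sum fun z _ => hR z).trans ?_)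
    rw [Finset.sum_const, smul_eq_mul]
    exact Nat.mul_le_mul_right R h.2.le
  · intro O _
    exact pinch_sdiff.symm
  · have key : ∀ O, Conn ends O A B → IsLeastPath s (OpenAdj ends (pinch ends col O
        (leastPath ends A B s O) (spots ends col A C O (leastPath ends A B s O)))) A B
        (leastPath ends A B s O) := fun O h =>
      (leastPath_spec s h).mono (fun _ _ h => h.mono pinch_subset)
        (chain_pinch (leastPath_spec s h).1.chain)
    have key' : ∀ O γ, spots ends col A C (pinch ends col O γ (spots ends col A C O γ)) γ =
        spots ends col A C O γ := fun O γ =>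
      spots_congr (F := (spots ends col A C O γ).biUnion (columnEdges ends col))
        (fun e he => exists_col_mem_of_mem_biUnion he) pinch_sdiff
    intro O₁ h₁ O₂ h₂ heq
    simp only [Finset.mem_filter, separated, Finset.mem_univ, true_and] at h₁ h₂ heq
    refine ⟨?_, fun h => h⟩
    -- The pinched configuration keeps its least path and its spots, so it reveals the set of edges
    -- at which it was altered.
    have hn₁ := key O₁ h₁.1.1
    rw [heq] at hn₁
    have hγ := hn₁.unique (key O₂ h₂.1.1)
    have hs₁ := key' O₁ (leastPath ends A B s O₁)
    rw [heq, hγ, key'] at hs₁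
    rw [hγ, hs₁]

/-- If `A` is connected to `B` and `C` to `D`, gluing has a bounded cost. -/
theorem weight_separated_inter_le (hε : 0 < ε) (hp : ε ≤ p) (hp' : p ≤ 1 - ε)
    (hR : ∀ z, (columnEdges ends col z).card ≤ R) (H : CrossingGraph ends col A B C D) :
    ∑ O ∈ (separated ends A B C).filter (fun O => Conn ends O C D), weight p O ≤
      4 * (2 / ε) ^ R * ∑ O ∈ joined ends A C, weight p O := by
  have hN : (0 : ℝ) < Fintype.card (Option V × V → Bool) := by exact_mod_cast Fintype.card_pos
  refine le_of_mul_le_mul_left (le_trans ?_ (sum_spots_le (B := B) hε hp hp' hR)) hN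
  rw [← nsmul_eq_mul, ← Finset.card_univ, ← Finset.sum_const]
  refine Finset.sum_le_sum fun s _ => ?_
  rw [Finset.sum_filter]
  refine Finset.sum_le_sum fun O hO => ?_
  simp only [separated, Finset.mem_filter, Finset.mem_univ, true_and] at hO
  have hw := weight_nonneg (show 0 ≤ p by linarith) (show p ≤ 1 by linarith) O
  split_ifs with hCD
  · have : 1 ≤ (spots ends col A C O (leastPath ends A B s O)).card :=
      Finset.card_pos.2 (H.spots_nonempty hO.2 hCD (leastPath_spec s hO.1).1)
    exact le_mul_of_one_le_left hw (by exact_mod_cast this)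
  · positivity

/-- If `C` is very likely to be connected to `D`, gluing is very likely. -/
theorem weight_separated_le (hε : 0 < ε) (hp : ε ≤ p) (hp' : p ≤ 1 - ε)
    (hR : ∀ z, (columnEdges ends col z).card ≤ R) (H : CrossingGraph ends col A B C D) {t : ℕ}
    (ht : 0 < t) :
    ∑ O ∈ separated ends A B C, weight p O ≤
      4 * (2 / ε) ^ R / t * ∑ O ∈ joined ends A C, weight p O +
        ((2 / ε) ^ R) ^ t * ∑ O ∈ unjoined ends C D, weight p O := by
  have hN : (0 : ℝ) < Fintype.card (Option V × V → Bool) := by exact_mod_cast Fintype.card_pos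
  have ht' : (0 : ℝ) < t := by exact_mod_cast ht
  refine le_of_mul_le_mul_left ?_ hN
  calc (Fintype.card (Option V × V → Bool) : ℝ) * ∑ O ∈ separated ends A B C, weight p O
      = ∑ s : Option V × V → Bool, ∑ O ∈ separated ends A B C, weight p O := by
        rw [Finset.sum_const, Finset.card_univ, nsmul_eq_mul]
    _ ≤ ∑ s : Option V × V → Bool, ((∑ O ∈ separated ends A B C,
          ((spots ends col A C O (leastPath ends A B s O)).card : ℝ) * weight p O) / t +
          ((2 / ε) ^ R) ^ t * ∑ O ∈ unjoined ends C D, weight p O) := by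
        refine Finset.sum_le_sum fun s _ => ?_
        refine le_trans ?_ (add_le_add_right (sum_few_spots_le hε hp hp' hR H s t) _)
        -- Markov's inequality: a configuration with at least `t` spots has weight at most its
        -- number of spots times its weight over `t`.
        rw [Finset.sum_filter, Finset.sum_div, ← Finset.sum_add_distrib]
        refine Finset.sum_le_sum fun O _ => ?_
        have hw := weight_nonneg (show 0 ≤ p by linarith) (show p ≤ 1 by linarith) O
        split_ifs with h
        · have : 0 ≤ ((spots ends col A C O (leastPath ends A B s O)).card : ℝ) *
            weight p O / t := by positivity
          linarith
        · rw [add_zero, le_div_iff₀ ht', mul_comm]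
          exact mul_le_mul_of_nonneg_right (by exact_mod_cast not_lt.1 h) hw
    _ = (∑ s : Option V × V → Bool, ∑ O ∈ separated ends A B C,
          ((spots ends col A C O (leastPath ends A B s O)).card : ℝ) * weight p O) / t +
        Fintype.card (Option V × V → Bool) *
          (((2 / ε) ^ R) ^ t * ∑ O ∈ unjoined ends C D, weight p O) := by
        rw [Finset.sum_add_distrib, Finset.sum_div, Finset.sum_const, Finset.card_univ,
          nsmul_eq_mul]
    _ ≤ (Fintype.card (Option V × V → Bool) *
        (4 * (2 / ε) ^ R * ∑ O ∈ joined ends A C, weight p O)) / t +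
        Fintype.card (Option V × V → Bool) *
          (((2 / ε) ^ R) ^ t * ∑ O ∈ unjoined ends C D, weight p O) := by
        gcongr
        exact sum_spots_le hε hp hp' hR
    _ = _ := by ring

end Estimates

/-! ### Increasing homeomorphisms below a family of lower bounds -/

section Homeo

/-- A continuous nondecreasing function that is small unless `x` is close to `1`. -/
noncomputable def ramp (δ : ℕ → ℝ) (x : ℝ) : ℝ :=
  ∑' n : ℕ, (1 / 2) ^ (n + 1) * max 0 (1 - |1 - x| / δ n)

/-- The absolute value in `ramp` makes this bound hold on the whole line, as uniform convergence
requires. -/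
theorem ramp_term_le {δ : ℕ → ℝ} (hδ : ∀ n, 0 < δ n) (n : ℕ) (x : ℝ) :
    (1 / 2 : ℝ) ^ (n + 1) * max 0 (1 - |1 - x| / δ n) ≤ (1 / 2) ^ (n + 1) := by
  have h : max 0 (1 - |1 - x| / δ n) ≤ 1 :=
    max_le zero_le_one (by have := div_nonneg (abs_nonneg (1 - x)) (hδ n).le; linarith)
  nlinarith [show (0 : ℝ) < (1 / 2) ^ (n + 1) by positivity]

theorem summable_half_pow : Summable fun n : ℕ => (1 / 2 : ℝ) ^ (n + 1) :=
  (summable_nat_add_iff 1).2 summable_geometric_two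

theorem summable_ramp {δ : ℕ → ℝ} (hδ : ∀ n, 0 < δ n) (x : ℝ) :
    Summable fun n : ℕ => (1 / 2 : ℝ) ^ (n + 1) * max 0 (1 - |1 - x| / δ n) :=
  summable_half_pow.of_nonneg_of_le (fun n => by positivity) fun n => ramp_term_le hδ n x

theorem continuous_ramp {δ : ℕ → ℝ} (hδ : ∀ n, 0 < δ n) : Continuous (ramp δ) := by
  refine continuous_tsum (fun n => by fun_prop) summable_half_pow fun n x => ?_
  rw [Real.norm_of_nonneg (by positivity)]
  exact ramp_term_le hδ n x

theorem ramp_mono {δ : ℕ → ℝ} (hδ : ∀ n, 0 < δ n) {x y : ℝ} (hxy : x ≤ y) (hy : y ≤ 1) :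
    ramp δ x ≤ ramp δ y := by
  refine (summable_ramp hδ x).tsum_le_tsum (fun n => ?_) (summable_ramp hδ y)
  refine mul_le_mul_of_nonneg_left (max_le_max le_rfl ?_) (by positivity)
  have h : |1 - y| / δ n ≤ |1 - x| / δ n := by
    rw [abs_of_nonneg (by linarith), abs_of_nonneg (by linarith)]
    exact div_le_div_of_nonneg_right (by linarith) (hδ n).le
  linarith

theorem ramp_one (δ : ℕ → ℝ) : ramp δ 1 = 1 := by
  have : ∑' n : ℕ, (1 / 2 : ℝ) ^ (n + 1) = 1 := by
    simp only [pow_succ]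
    rw [tsum_mul_right, tsum_geometric_two]
    norm_num
  simpa [ramp] using this

/-- A partial sum equals the one up to its last active index `n`, which is at most `1 - (1 / 2) ^ (n
+ 1)`, a lower bound for `q` by hypothesis. No monotonicity of `δ` is needed. -/
theorem ramp_le {δ : ℕ → ℝ} (hδ : ∀ n, 0 < δ n) {x q : ℝ} (hx : x ≤ 1) (hq : 0 ≤ q)
    (h : ∀ n : ℕ, 1 - δ n ≤ x → 1 - (1 / 2) ^ (n + 1) ≤ q) : ramp δ x ≤ q := by
  refine (summable_ramp hδ x).tsum_le_of_sum_range_le fun N => ?_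
  induction N with
  | zero => simpa using hq
  | succ N ih =>
    by_cases hN : 1 - δ N ≤ x
    · refine le_trans (Finset.sum_le_sum fun n _ => ramp_term_le hδ n x) (le_trans ?_ (h N hN))
      have : ∀ N : ℕ, ∑ n ∈ Finset.range N, (1 / 2 : ℝ) ^ (n + 1) = 1 - (1 / 2) ^ N := by
        intro N
        induction N with
        | zero => simp
        | succ N ih => rw [Finset.sum_range_succ, ih, pow_succ]; ring
      rw [this]
    · rw [Finset.sum_range_succ]
      have : 1 - |1 - x| / δ N ≤ 0 := by
        rw [abs_of_nonneg (by linarith), sub_nonpos, one_le_div (hδ N)]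
        linarith
      rw [max_eq_left this]
      simpa using ih

theorem exists_increasingHomeo_le {c : ℝ} (hc : 0 < c) (hc1 : c ≤ 1) {δ : ℕ → ℝ}
    (hδ : ∀ n, 0 < δ n) : ∃ h ∈ increasingHomeos, ∀ x q : I, c * (x : ℝ) ^ 2 ≤ q →
      (∀ n : ℕ, 1 - δ n ≤ (x : ℝ) → 1 - (1 / 2) ^ (n + 1) ≤ (q : ℝ)) → h x ≤ q := by
  -- The factor `x` gives strict monotonicity where the maximum is flat, the term `c * x` keeps the
  -- maximum positive for `x > 0`, and `c ≤ 1` gives the value `1` at `1`.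
  set H : ℝ → ℝ := fun x => x * max (c * x) (ramp δ x) with hH
  have hcont : Continuous H :=
    continuous_id.mul ((continuous_const.mul continuous_id).max (continuous_ramp hδ))
  have hstrict : ∀ x y : ℝ, 0 ≤ x → x < y → y ≤ 1 → H x < H y := by
    intro x y hx hxy hy
    have h1 : max (c * x) (ramp δ x) ≤ max (c * y) (ramp δ y) :=
      max_le_max (by nlinarith) (ramp_mono hδ hxy.le hy)
    have h2 : 0 < max (c * y) (ramp δ y) :=
      lt_of_lt_of_le (mul_pos hc (hx.trans_lt hxy)) (le_max_left _ _)
    calc H x ≤ x * max (c * y) (ramp δ y) := mul_le_mul_of_nonneg_left h1 hx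
      _ < H y := mul_lt_mul_of_pos_right hxy h2
  have h0 : H 0 = 0 := by simp [hH]
  have h1 : H 1 = 1 := by simp [hH, ramp_one, hc1]
  have hmem : ∀ x : I, H x ∈ I := by
    intro x
    constructor
    · rcases eq_or_lt_of_le x.2.1 with h | h
      · rw [← h, h0]
      · rw [← h0]; exact (hstrict 0 x le_rfl h x.2.2).le
    · rcases eq_or_lt_of_le x.2.2 with h | h
      · rw [h, h1]
      · rw [← h1]; exact (hstrict x 1 x.2.1 h le_rfl).le
  refine ⟨fun x => ⟨H x, hmem x⟩, ⟨?_, ?_, ?_⟩, ?_⟩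
  · exact (hcont.comp continuous_subtype_val).subtype_mk _
  · intro x y hxy
    exact hstrict x y x.2.1 hxy y.2.2
  · intro y
    have := intermediate_value_Icc zero_le_one hcont.continuousOn
    rw [h0, h1] at this
    obtain ⟨x, hx, hxy⟩ := this y.2
    exact ⟨⟨x, hx⟩, Subtype.ext hxy⟩
  · intro x q h2 h3
    show H x ≤ q
    rw [hH]
    simp only
    rw [mul_max_of_nonneg _ _ x.2.1]
    refine max_le (by nlinarith) ?_
    have hr := ramp_le hδ x.2.2 q.2.1 h3
    rcases le_total 0 (ramp δ x) with hpos | hneg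
    · exact (mul_le_of_le_one_left hpos x.2.2).trans hr
    · exact (mul_nonpos_of_nonneg_of_nonpos x.2.1 hneg).trans q.2.1

/-- The two gluing estimates, in the form of a single increasing homeomorphism. -/
theorem exists_increasingHomeo_of_estimates {K : ℝ} (hK : 0 < K) :
    ∃ h ∈ increasingHomeos, ∀ x y q : I, (x : ℝ) * y ≤ (1 + 4 * K) * q →
      (∀ t : ℕ, 0 < t → (x : ℝ) ≤ q + 4 * K / t * q + K ^ t * (1 - y)) → h (min x y) ≤ q := by
  have hex : ∀ n : ℕ, ∃ d : ℝ, 0 < d ∧ ∀ x y q : I,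
      (∀ t : ℕ, 0 < t → (x : ℝ) ≤ q + 4 * K / t * q + K ^ t * (1 - y)) →
      1 - d ≤ ((min x y : I) : ℝ) → 1 - (1 / 2) ^ (n + 1) ≤ (q : ℝ) := by
    intro n
    set η : ℝ := (1 / 2) ^ (n + 1) with hη
    have hη0 : 0 < η := by positivity
    obtain ⟨t, ht⟩ := exists_nat_gt (4 * K / (η / 2))
    have ht0 : (0 : ℝ) < t := lt_trans (by positivity) ht
    have hKt : 4 * K / t ≤ η / 2 := by
      rw [div_lt_iff₀ (by positivity)] at ht
      rw [div_le_iff₀ ht0]; linarith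
    -- The deficit `1 - q` has three parts: `4 * K / t ≤ η / 2` by the choice of `t`, then at most
    -- `d` from `x` and `K ^ t * d` from `y`. This `d` makes the last two add up to `η / 2`.
    refine ⟨η / 2 / (1 + K ^ t), by positivity, fun x y q h hx => ?_⟩
    set d := η / 2 / (1 + K ^ t) with hd
    have hdK : d + K ^ t * d = η / 2 := by rw [hd]; field_simp
    have hmin₁ : ((min x y : I) : ℝ) ≤ x := min_le_left x y
    have hmin₂ : ((min x y : I) : ℝ) ≤ y := min_le_right x y
    have h1 := h t (by exact_mod_cast ht0)
    have h2 : 4 * K / t * q ≤ η / 2 := by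
      have : 4 * K / t * q ≤ 4 * K / t := mul_le_of_le_one_right (by positivity) q.2.2
      linarith
    have h3 : K ^ t * (1 - (y : ℝ)) ≤ K ^ t * d :=
      mul_le_mul_of_nonneg_left (by linarith) (by positivity)
    linarith
  choose d hd hdq using hex
  obtain ⟨h, hh, hle⟩ := exists_increasingHomeo_le (c := 1 / (1 + 4 * K)) (by positivity)
    (by rw [div_le_one (by positivity)]; linarith) hd
  refine ⟨h, hh, fun x y q h1 h2 => hle _ _ ?_ fun n hn => hdq n x y q h2 hn⟩
  have hmin₁ : ((min x y : I) : ℝ) ≤ x := min_le_left x y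
  have hmin₂ : ((min x y : I) : ℝ) ≤ y := min_le_right x y
  have hmin₀ : 0 ≤ ((min x y : I) : ℝ) := (min x y : I).2.1
  rw [div_mul_eq_mul_div, one_mul, div_le_iff₀ (by positivity)]
  calc ((min x y : I) : ℝ) ^ 2 ≤ x * y := by
        rw [sq]; exact mul_le_mul hmin₁ hmin₂ hmin₀ x.2.1
    _ ≤ q * (1 + 4 * K) := by linarith

end Homeo

/-! ### Positive association -/

section Association

open scoped Classical

variable {E : Type*} [Fintype E]

/-- For a product measure the lattice condition of the FKG inequality is an equality, edge by edge.
-/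
theorem weight_mul_weight (p : ℝ) (O O' : Finset E) :
    weight p O * weight p O' = weight p (O ⊓ O') * weight p (O ⊔ O') := by
  unfold weight
  rw [← Finset.prod_mul_distrib, ← Finset.prod_mul_distrib]
  refine Finset.prod_congr rfl fun e _ => ?_
  simp only [Finset.inf_eq_inter, Finset.sup_eq_union, Finset.mem_inter, Finset.mem_union]
  by_cases h : e ∈ O <;> by_cases h' : e ∈ O' <;> simp [h, h', mul_comm]

theorem sum_weight_mul_le {p : ℝ} (h0 : 0 ≤ p) (h1 : p ≤ 1) {P Q : Finset E → Prop}
    (hP : ∀ O O', O ⊆ O' → P O → P O') (hQ : ∀ O O', O ⊆ O' → Q O → Q O') :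
    (∑ O with P O, weight p O) * (∑ O with Q O, weight p O) ≤
      (∑ O : Finset E, weight p O) * ∑ O with P O ∧ Q O, weight p O := by
  have hind : ∀ R : Finset E → Prop, (∀ O O', O ⊆ O' → R O → R O') →
      Monotone fun O => if R O then (1 : ℝ) else 0 := by
    intro R hR O O' h
    simp only
    split_ifs with h1 h2
    · exact le_rfl
    · exact absurd (hR _ _ h h1) h2
    · exact zero_le_one
    · exact le_rfl
  have := fkg (μ := weight p) (f := fun O => if P O then (1 : ℝ) else 0)
    (g := fun O => if Q O then (1 : ℝ) else 0) (fun O => weight_nonneg h0 h1 O)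
    (fun O => by simp only [Pi.zero_apply]; split_ifs <;> norm_num)
    (fun O => by simp only [Pi.zero_apply]; split_ifs <;> norm_num)
    (hind P hP) (hind Q hQ) (fun O O' => (weight_mul_weight p O O').le)
  simpa only [mul_ite, mul_one, mul_zero, ← Finset.sum_filter, Finset.filter_filter, ite_mul,
    one_mul, zero_mul, ← ite_and, and_comm] using this

end Association

/-! ### The slab -/

section Slab

open scoped Classical

set_option linter.unusedSectionVars false

variable {k : ℕ}

/-- The edges of the slab with both endpoints in `S`. -/
abbrev EdgesIn (S : Set (Slab k)) : Type := {e : (slabGraph k).edgeSet // ∀ x ∈ e.1, x ∈ S}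

/-- The endpoints of an edge of `S`. -/
def endsIn (S : Set (Slab k)) (e : EdgesIn S) : Sym2 S := e.1.1.attachWith e.2

/-- The column of a vertex of `S`. -/
def colIn (S : Set (Slab k)) (v : S) : ℤ × ℤ := slabProj v.1

theorem endsIn_eq_iff {S : Set (Slab k)} {e : EdgesIn S} {u v : S} :
    endsIn S e = s(u, v) ↔ e.1.1 = s(u.1, v.1) := by
  rw [← (Sym2.map.injective Subtype.val_injective).eq_iff, endsIn,
    Sym2.attachWith_map_subtypeVal, Sym2.map_mk]

theorem mem_endsIn_iff {S : Set (Slab k)} {e : EdgesIn S} {u : S} :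
    u ∈ endsIn S e ↔ u.1 ∈ e.1.1 := by
  rw [show u.1 ∈ e.1.1 ↔ u.1 ∈ (endsIn S e).map Subtype.val by
    rw [endsIn, Sym2.attachWith_map_subtypeVal], Sym2.mem_map]
  exact ⟨fun h => ⟨u, h, rfl⟩, fun ⟨v, hv, h⟩ => Subtype.ext h ▸ hv⟩

theorem endsIn_injective (S : Set (Slab k)) : Function.Injective (endsIn S) := by
  intro e e' h
  have := congrArg (Sym2.map Subtype.val) h
  simp only [endsIn, Sym2.attachWith_map_subtypeVal] at this
  exact Subtype.ext (Subtype.ext this)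

theorem slabRect_finite (k : ℕ) (a b c d : ℤ) : (slabRect k a b c d).Finite := by
  have : slabRect k a b c d ⊆ (Set.Icc a b ×ˢ Set.Icc c d) ×ˢ (Set.univ : Set (Fin (k + 1))) :=
    fun x hx => ⟨hx, Set.mem_univ _⟩
  exact (((Set.finite_Icc a b).prod (Set.finite_Icc c d)).prod Set.finite_univ).subset this

variable {S : Set (Slab k)} [Fintype S] [Fintype (EdgesIn S)]

/-- The set of open edges of `S`. -/
noncomputable def openEdges (S : Set (Slab k)) [Fintype (EdgesIn S)] (ω : Config k) :
    Finset (EdgesIn S) := {e | ω e.1 = true}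

theorem openAdj_openEdges_iff {ω : Config k} {u v : S} :
    OpenAdj (endsIn S) (openEdges S ω) u v ↔
      ∃ h : (slabGraph k).Adj u.1 v.1, ω ⟨s(u.1, v.1), h⟩ = true := by
  constructor
  · rintro ⟨e, he, h⟩
    rw [endsIn_eq_iff] at h
    simp only [openEdges, Finset.mem_filter, Finset.mem_univ, true_and] at he
    have hadj : (slabGraph k).Adj u.1 v.1 := by
      rw [← SimpleGraph.mem_edgeSet, ← h]; exact e.1.2
    refine ⟨hadj, ?_⟩
    have : e.1 = ⟨s(u.1, v.1), hadj⟩ := Subtype.ext h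
    rwa [← this]
  · rintro ⟨h, hω⟩
    refine ⟨⟨⟨s(u.1, v.1), h⟩, ?_⟩, ?_, endsIn_eq_iff.2 rfl⟩
    · intro x hx
      rw [Sym2.mem_iff] at hx
      rcases hx with rfl | rfl
      · exact u.2
      · exact v.2
    · simpa [openEdges] using hω

theorem reflTransGen_of_walk {ω : Config k} {x y : Slab k} (w : (slabGraph k).Walk x y)
    (hS : ∀ v ∈ w.support, v ∈ S) (hω : IsOpenWalk ω w) :
    ∃ (hx : x ∈ S) (hy : y ∈ S),
      Relation.ReflTransGen (OpenAdj (endsIn S) (openEdges S ω)) ⟨x, hx⟩ ⟨y, hy⟩ := by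
  induction w with
  | nil => exact ⟨hS _ (by simp), hS _ (by simp), .refl⟩
  | @cons u v w h p ih =>
    obtain ⟨hv, hw, hr⟩ := ih (fun z hz => hS z (by simp [hz]))
      (fun e he => hω e (by simp [he]))
    refine ⟨hS u (by simp), hw, .head (b := ⟨v, hv⟩) ?_ hr⟩
    exact openAdj_openEdges_iff.2 ⟨h, hω s(u, v) (by simp)⟩

/-- The predicate `Q` carries a constraint on all visited vertices, such as being on a given list or
off its columns. -/
theorem exists_walk_of_reflTransGen {ω : Config k} {r : S → S → Prop} {Q : S → Prop}
    (hr : ∀ u v, r u v → OpenAdj (endsIn S) (openEdges S ω) u v ∧ Q v) {x y : S}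
    (h : Relation.ReflTransGen r x y) (hx : Q x) :
    ∃ w : (slabGraph k).Walk x.1 y.1, (∀ v ∈ w.support, ∃ hv : v ∈ S, Q ⟨v, hv⟩) ∧
      IsOpenWalk ω w := by
  induction h using Relation.ReflTransGen.head_induction_on with
  | refl => exact ⟨.nil, by simpa using hx, fun e he => by simp at he⟩
  | @head u v huv _ ih =>
    obtain ⟨h1, h2⟩ := hr u v huv
    obtain ⟨w, hw, hwo⟩ := ih h2
    obtain ⟨hadj, hopen⟩ := openAdj_openEdges_iff.1 h1
    refine ⟨.cons hadj w, ?_, ?_⟩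
    · intro z hz
      rw [SimpleGraph.Walk.support_cons, List.mem_cons] at hz
      rcases hz with rfl | hz
      · exact ⟨u.2, hx⟩
      · exact hw z hz
    · intro e he
      have he' := he
      rw [SimpleGraph.Walk.edges_cons, List.mem_cons] at he'
      rcases he' with rfl | he'
      · exact hopen
      · exact hwo e he'

/-- The vertices of `S` that lie in `A`. -/
abbrev inside (S A : Set (Slab k)) : Set S := Subtype.val ⁻¹' A

theorem mem_connected_iff {A B : Set (Slab k)} {ω : Config k} :
    ω ∈ connected A B S ↔ Conn (endsIn S) (openEdges S ω) (inside S A) (inside S B) := by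
  constructor
  · rintro ⟨x, y, w, ⟨hx, hy, hS⟩, hω⟩
    obtain ⟨hxS, hyS, h⟩ := reflTransGen_of_walk w hS hω
    exact ⟨⟨x, hxS⟩, hx, ⟨y, hyS⟩, hy, h⟩
  · rintro ⟨x, hx, y, hy, h⟩
    obtain ⟨w, hw, hω⟩ := exists_walk_of_reflTransGen (Q := fun _ => True)
      (fun u v h => ⟨h, trivial⟩) h trivial
    exact ⟨x, y, w, ⟨hx, hy, fun v hv => (hw v hv).1⟩, hω⟩

/-! ### The percolation law restricted to a finite set of edges -/

theorem measurableSet_openEdges_eq (O : Finset (EdgesIn S)) :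
    MeasurableSet {ω : Config k | openEdges S ω = O} := by
  have : {ω : Config k | openEdges S ω = O} =
      ⋂ e : EdgesIn S, (fun ω : Config k => ω e.1) ⁻¹' {decide (e ∈ O)} := by
    ext ω
    simp only [Set.mem_ofPred_eq, Set.mem_iInter, Set.mem_preimage, Set.mem_singleton_iff]
    rw [Finset.ext_iff]
    refine forall_congr' fun e => ?_
    simp only [openEdges, Finset.mem_filter, Finset.mem_univ, true_and]
    by_cases h : e ∈ O <;> simp [h]
  rw [this]
  exact MeasurableSet.iInter fun e => measurable_pi_apply e.1 (MeasurableSet.singleton _)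

theorem percLaw_real_openEdges_eq (p : I) (O : Finset (EdgesIn S)) :
    (percLaw k p).real {ω | openEdges S ω = O} = weight (p : ℝ) O := by
  let s : Finset (slabGraph k).edgeSet := Finset.univ.map
    (⟨Subtype.val, Subtype.val_injective⟩ : EdgesIn S ↪ (slabGraph k).edgeSet)
  have hset : {ω : Config k | openEdges S ω = O} =
      Set.pi s fun i => {decide (∃ e ∈ O, e.1 = i)} := by
    ext ω
    simp only [Set.mem_ofPred_eq, Set.mem_pi, Set.mem_singleton_iff, s, Finset.coe_map,
      Set.mem_image, Finset.coe_univ, Set.mem_univ, true_and, Function.Embedding.coeFn_mk,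
      forall_exists_index, forall_apply_eq_imp_iff]
    rw [Finset.ext_iff]
    refine forall_congr' fun e => ?_
    have : (∃ e' ∈ O, e'.1 = e.1) ↔ e ∈ O :=
      ⟨fun ⟨e', h, h'⟩ => Subtype.ext h' ▸ h, fun h => ⟨e, h, rfl⟩⟩
    simp only [openEdges, Finset.mem_filter, Finset.mem_univ, true_and, this]
    by_cases h : e ∈ O <;> simp [h]
  rw [hset, measureReal_def, percLaw, Measure.infinitePi_pi _ (fun i _ => MeasurableSet.singleton _),
    ENNReal.toReal_prod, Finset.prod_map, weight]
  refine Finset.prod_congr rfl fun e _ => ?_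
  have : (∃ e' ∈ O, e'.1 = e.1) ↔ e ∈ O :=
    ⟨fun ⟨e', h, h'⟩ => Subtype.ext h' ▸ h, fun h => ⟨e, h, rfl⟩⟩
  rw [← measureReal_def, bernoulliMeasure_real_apply p (MeasurableSet.singleton _)]
  by_cases h : e ∈ O <;> simp [h, this]

theorem percLaw_real_eq_sum (p : I) (P : Finset (EdgesIn S) → Prop) :
    (percLaw k p).real {ω | P (openEdges S ω)} = ∑ O with P O, weight (p : ℝ) O := by
  have : {ω : Config k | P (openEdges S ω)} =
      ⋃ O ∈ Finset.univ.filter P, {ω | openEdges S ω = O} := by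
    ext ω
    simp
  rw [this, measureReal_biUnion_finset]
  · exact Finset.sum_congr rfl fun O _ => percLaw_real_openEdges_eq p O
  · intro O _ O' _ h
    refine Set.disjoint_left.2 fun ω h1 h2 => h ?_
    simp only [Set.mem_ofPred_eq] at h1 h2
    rw [← h1, ← h2]
  · exact fun O _ => measurableSet_openEdges_eq O

theorem connProb_eq_sum (p : I) (A B : Set (Slab k)) :
    (connProb p A B S : ℝ) = ∑ O ∈ joined (endsIn S) (inside S A) (inside S B), weight (p : ℝ) O := by
  rw [joined, ← percLaw_real_eq_sum]
  show (percLaw k p).real _ = _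
  congr 1
  ext ω
  exact mem_connected_iff

theorem sum_weight_eq_one (p : I) : ∑ O : Finset (EdgesIn S), weight (p : ℝ) O = 1 := by
  have := percLaw_real_eq_sum (S := S) p fun _ => True
  simpa using this.symm

/-! ### Columns and crossings in the rectangle -/

theorem column_connected (a b c d : ℤ) [Fintype (slabRect k a b c d)]
    [Fintype (EdgesIn (slabRect k a b c d))] (u v : slabRect k a b c d)
    (huv : colIn _ u = colIn _ v) :
    Relation.ReflTransGen (fun x y => colIn _ x = colIn _ u ∧
      OpenAdj (endsIn (slabRect k a b c d)) Finset.univ x y) u v := by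
  obtain ⟨⟨z, i⟩, hu⟩ := u
  obtain ⟨⟨z', j⟩, hv⟩ := v
  obtain rfl : z = z' := huv
  -- The full graph is the all-open configuration, so adjacency in it is described by
  -- `openAdj_openEdges_iff`.
  have huniv : (Finset.univ : Finset (EdgesIn (slabRect k a b c d))) =
      openEdges _ fun _ => true := by
    ext e; simp [openEdges]
  have hmem : ∀ i : Fin (k + 1), (z, i) ∈ slabRect k a b c d := fun _ => hu
  have hadj : ∀ i j : Fin (k + 1), (j : ℕ) = i + 1 →
      OpenAdj (endsIn (slabRect k a b c d)) Finset.univ ⟨(z, i), hmem i⟩ ⟨(z, j), hmem j⟩ := by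
    intro i j hij
    rw [huniv]
    refine openAdj_openEdges_iff.2 ⟨?_, rfl⟩
    show (z.1 - z.1) ^ 2 + (z.2 - z.2) ^ 2 + (((i : ℕ) : ℤ) - ((j : ℕ) : ℤ)) ^ 2 = 1
    rw [hij]; push_cast; ring
  -- Both directions are carried along, so that any two vertices can be joined through height `0`.
  have key : ∀ n (hn : n < k + 1),
      Relation.ReflTransGen (fun x y => colIn _ x = z ∧
        OpenAdj (endsIn (slabRect k a b c d)) Finset.univ x y)
        ⟨(z, 0), hmem 0⟩ ⟨(z, ⟨n, hn⟩), hmem _⟩ ∧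
      Relation.ReflTransGen (fun x y => colIn _ x = z ∧
        OpenAdj (endsIn (slabRect k a b c d)) Finset.univ x y)
        ⟨(z, ⟨n, hn⟩), hmem _⟩ ⟨(z, 0), hmem 0⟩ := by
    intro n
    induction n with
    | zero => exact fun hn => ⟨.refl, .refl⟩
    | succ n ih =>
      intro hn
      obtain ⟨h1, h2⟩ := ih (by omega)
      have h := hadj ⟨n, by omega⟩ ⟨n + 1, hn⟩ rfl
      exact ⟨h1.tail ⟨rfl, h⟩, h2.head ⟨rfl, h.symm⟩⟩
  exact (key i i.2).2.trans (key j j.2).1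

/-- An edge at the column `z` is encoded by the height of an endpoint there, a planar offset in a 3
by 3 square and the height of the other endpoint. -/
theorem columnEdges_card_le (z : ℤ × ℤ) :
    (columnEdges (endsIn S) (colIn S) z).card ≤ (k + 1) * (9 * (k + 1)) := by
  let T : Finset (Sym2 (Slab k)) :=
    ((Finset.univ : Finset (Fin (k + 1))) ×ˢ ((Finset.Icc (-1 : ℤ) 1 ×ˢ Finset.Icc (-1 : ℤ) 1) ×ˢ
      (Finset.univ : Finset (Fin (k + 1))))).image
      fun q => s((z, q.1), ((z.1 + q.2.1.1, z.2 + q.2.1.2), q.2.2))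
  have hT : T.card ≤ (k + 1) * (9 * (k + 1)) := by
    refine Finset.card_image_le.trans (le_of_eq ?_)
    simp [Finset.card_product]
  refine le_trans (Finset.card_le_card_of_injOn (fun e => e.1.1) ?_ ?_) hT
  · intro e he
    simp only [columnEdges, Finset.coe_filter, Finset.mem_univ, true_and, Set.mem_ofPred_eq] at he
    obtain ⟨x, hx, hxz⟩ := he
    rw [mem_endsIn_iff] at hx
    obtain ⟨y, hy⟩ := Sym2.mem_iff_exists.1 hx
    have hadj : (slabGraph k).Adj x.1 y := by
      rw [← SimpleGraph.mem_edgeSet, ← hy]; exact e.1.2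
    have hadj' : (x.1.1.1 - y.1.1) ^ 2 + (x.1.1.2 - y.1.2) ^ 2 + ((x.1.2 : ℤ) - (y.2 : ℤ)) ^ 2 = 1 :=
      hadj
    have hxz' : x.1.1 = z := hxz
    simp only [T, Finset.coe_image, Set.mem_image, Finset.mem_coe, Finset.mem_product,
      Finset.mem_univ, true_and, and_true, Finset.mem_Icc]
    refine ⟨(x.1.2, ((y.1.1 - z.1, y.1.2 - z.2), y.2)), ?_, ?_⟩
    · rw [hxz'] at hadj'
      have h1 := sq_nonneg (z.1 - y.1.1)
      have h2 := sq_nonneg (z.2 - y.1.2)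
      have h3 := sq_nonneg ((x.1.2 : ℤ) - (y.2 : ℤ))
      have h4 : (z.1 - y.1.1) ^ 2 ≤ 1 := by linarith
      have h5 : (z.2 - y.1.2) ^ 2 ≤ 1 := by linarith
      have h6 := abs_le.1 ((sq_le_one_iff_abs_le_one _).1 h4)
      have h7 := abs_le.1 ((sq_le_one_iff_abs_le_one _).1 h5)
      refine ⟨⟨?_, ?_⟩, ?_, ?_⟩ <;> simp only <;> linarith
    · rw [hy]
      have e1 : (z, x.1.2) = x.1 := by rw [← hxz']
      have e2 : ((z.1 + (y.1.1 - z.1), z.2 + (y.1.2 - z.2)), y.2) = y := by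
        simp
      simp only [e1, e2]
  · intro e _ e' _ h
    exact Subtype.ext (Subtype.ext h)

theorem crossingGraph_slabRect {a b c d : ℤ} [Fintype (slabRect k a b c d)]
    [Fintype (EdgesIn (slabRect k a b c d))] {A B C D : Set (Slab k)}
    (hCD : Disjoint (slabProj '' C) (slabProj '' D))
    (hcross : ∀ (x y u v : Slab k) (w₁ : (slabGraph k).Walk x y) (w₂ : (slabGraph k).Walk u v),
      IsPathFromToIn A B (slabRect k a b c d) w₁ → IsPathFromToIn C D (slabRect k a b c d) w₂ →
      (projTrace w₁ ∩ projTrace w₂).Nonempty) :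
    CrossingGraph (endsIn (slabRect k a b c d)) (colIn (slabRect k a b c d))
      (inside _ A) (inside _ B) (inside _ C) (inside _ D) := by
  have huniv : (Finset.univ : Finset (EdgesIn (slabRect k a b c d))) =
      openEdges _ fun _ => true := by
    ext e; simp [openEdges]
  refine ⟨column_connected a b c d, ?_, ?_⟩
  · refine Set.disjoint_left.2 fun x hx hx' => ?_
    exact Set.disjoint_left.1 hCD ⟨x.1, hx, rfl⟩ ⟨x.1, hx', rfl⟩
  · rintro l hl ⟨x, t, hx, hxA⟩ ⟨t', y, hy, hyB⟩ u hu v hv hul hr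
    rw [huniv] at hl hr
    have hxy : Relation.ReflTransGen (fun p q => OpenAdj (endsIn (slabRect k a b c d))
        (openEdges _ fun _ => true) p q ∧ q ∈ l) x y := by
      have hl' : l.IsChain fun p q => OpenAdj (endsIn (slabRect k a b c d))
          (openEdges _ fun _ => true) p q ∧ q ∈ l :=
        hl.imp_of_mem_imp fun p q _ hq h => ⟨h, hq⟩
      rw [hx] at hl' hy ⊢
      exact reflTransGen_of_chain hl' hy
    obtain ⟨w₁, hw₁, -⟩ := exists_walk_of_reflTransGen (Q := fun q => q ∈ l)
      (fun _ _ h => h) hxy (by rw [hx]; simp)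
    obtain ⟨w₂, hw₂, -⟩ := exists_walk_of_reflTransGen
      (Q := fun q => colIn _ q ∉ cols (colIn (slabRect k a b c d)) l) (fun _ _ h => h) hr hul
    obtain ⟨z, ⟨p, hp, rfl⟩, q, hq, hqz⟩ := hcross _ _ _ _ w₁ w₂
      ⟨hxA, hyB, fun v hv => (hw₁ v hv).1⟩ ⟨hu, hv, fun v hv => (hw₂ v hv).1⟩
    obtain ⟨hpS, hpl⟩ := hw₁ p hp
    obtain ⟨hqS, hql⟩ := hw₂ q hq
    exact hql ⟨⟨p, hpS⟩, hpl, hqz.symm⟩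

/-! ### From weighted sums to connection probabilities -/

theorem conn_symm {V E : Type*} [Fintype V] [Fintype E] {ends : E → Sym2 V} {O : Finset E}
    {P Q : Set V} (h : Conn ends O P Q) : Conn ends O Q P := by
  obtain ⟨x, hx, y, hy, h⟩ := h
  exact ⟨y, hy, x, hx, reflTransGen_openAdj_symm h⟩

theorem conn_mono {V E : Type*} [Fintype V] [Fintype E] {ends : E → Sym2 V} {O O' : Finset E}
    {P Q : Set V} (hO : O ⊆ O') (h : Conn ends O P Q) : Conn ends O' P Q := by
  obtain ⟨x, hx, y, hy, h⟩ := h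
  exact ⟨x, hx, y, hy, Relation.ReflTransGen.mono (fun _ _ h => h.mono hO) _ _ h⟩

theorem sum_le_sum_add_sum_of_subset_union {ι : Type*} {f : ι → ℝ} (hf : ∀ i, 0 ≤ f i)
    {s t u : Finset ι} (h : s ⊆ t ∪ u) : ∑ i ∈ s, f i ≤ ∑ i ∈ t, f i + ∑ i ∈ u, f i := by
  rw [← Finset.sum_union_inter]
  have h1 := Finset.sum_le_sum_of_subset_of_nonneg h fun i _ _ => hf i
  have h2 := Finset.sum_nonneg fun i (_ : i ∈ t ∩ u) => hf i
  linarith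

/-- The gluing estimates in terms of connection probabilities. -/
theorem connProb_estimates {a b c d : ℤ} {A B C D : Set (Slab k)} {ε : ℝ} (hε : 0 < ε) {p : I}
    (hp : ε ≤ (p : ℝ)) (hp' : (p : ℝ) ≤ 1 - ε)
    (hCD : Disjoint (slabProj '' C) (slabProj '' D))
    (hcross : ∀ (x y u v : Slab k) (w₁ : (slabGraph k).Walk x y) (w₂ : (slabGraph k).Walk u v),
      IsPathFromToIn A B (slabRect k a b c d) w₁ → IsPathFromToIn C D (slabRect k a b c d) w₂ →
      (projTrace w₁ ∩ projTrace w₂).Nonempty) {K : ℝ}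
    (hK : K = (2 / ε) ^ ((k + 1) * (9 * (k + 1)))) :
    (connProb p A B (slabRect k a b c d) : ℝ) * connProb p C D (slabRect k a b c d) ≤
      (1 + 4 * K) * connProb p C A (slabRect k a b c d) ∧
    ∀ t : ℕ, 0 < t → (connProb p A B (slabRect k a b c d) : ℝ) ≤
      connProb p C A (slabRect k a b c d) + 4 * K / t * connProb p C A (slabRect k a b c d) +
        K ^ t * (1 - connProb p C D (slabRect k a b c d)) := by
  have : Fintype (slabRect k a b c d) := (slabRect_finite k a b c d).fintype
  have : Fintype (EdgesIn (slabRect k a b c d)) := Fintype.ofInjective _ (endsIn_injective _)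
  set S := slabRect k a b c d with hS
  have H := crossingGraph_slabRect hCD hcross
  have hR := columnEdges_card_le (S := S)
  have hw : ∀ O : Finset (EdgesIn S), 0 ≤ weight (p : ℝ) O := weight_nonneg p.2.1 p.2.2
  have hCA : joined (endsIn S) (inside S C) (inside S A) =
      joined (endsIn S) (inside S A) (inside S C) := by
    ext O
    simp only [joined, Finset.mem_filter, Finset.mem_univ, true_and]
    exact ⟨conn_symm, conn_symm⟩
  rw [connProb_eq_sum, connProb_eq_sum, connProb_eq_sum, hCA]
  have e1 := weight_separated_inter_le hε hp hp' hR H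
  have e2 := fun t ht => weight_separated_le hε hp hp' hR H (t := t) ht
  rw [← hK] at e1
  simp only [← hK] at e2
  constructor
  · have hfkg := sum_weight_mul_le p.2.1 p.2.2
      (P := fun O => Conn (endsIn S) O (inside S A) (inside S B))
      (Q := fun O => Conn (endsIn S) O (inside S C) (inside S D))
      (fun _ _ hO h => conn_mono hO h) (fun _ _ hO h => conn_mono hO h)
    rw [sum_weight_eq_one, one_mul] at hfkg
    have hsub : (Finset.univ.filter fun O => Conn (endsIn S) O (inside S A) (inside S B) ∧
        Conn (endsIn S) O (inside S C) (inside S D)) ⊆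
        joined (endsIn S) (inside S A) (inside S C) ∪
        (separated (endsIn S) (inside S A) (inside S B) (inside S C)).filter
          fun O => Conn (endsIn S) O (inside S C) (inside S D) := by
      intro O hO
      simp only [joined, separated, Finset.mem_union, Finset.mem_filter, Finset.mem_univ,
        true_and] at hO ⊢
      tauto
    have h1 := sum_le_sum_add_sum_of_subset_union hw hsub
    calc _ ≤ _ := hfkg
      _ ≤ _ := h1
      _ ≤ _ := by linarith
  · intro t ht
    have hsub : joined (endsIn S) (inside S A) (inside S B) ⊆
        joined (endsIn S) (inside S A) (inside S C) ∪
        separated (endsIn S) (inside S A) (inside S B) (inside S C) := by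
      intro O hO
      simp only [joined, separated, Finset.mem_union, Finset.mem_filter, Finset.mem_univ,
        true_and] at hO ⊢
      tauto
    have h1 := sum_le_sum_add_sum_of_subset_union hw hsub
    have h2 : ∑ O ∈ unjoined (endsIn S) (inside S C) (inside S D), weight (p : ℝ) O =
        1 - ∑ O ∈ joined (endsIn S) (inside S C) (inside S D), weight (p : ℝ) O := by
      rw [← sum_weight_eq_one (S := S) p, unjoined, joined, eq_sub_iff_add_eq, add_comm]
      exact Finset.sum_filter_add_sum_filter_not _ _ _
    have h3 := e2 t ht
    rw [h2] at h3
    linarith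

end Slab

end Gluing

theorem theorem3p4 (k : ℕ) (hk : 1 ≤ k) (ε : ℝ) (hε : 0 < ε) :
    ∃ h₀ ∈ increasingHomeos,
      ∀ (a b c d : ℤ), 5 ≤ b - a → 5 ≤ d - c →
      ∀ (A B C D : Set (Slab k)),
        A ⊆ vertexBoundary (slabRect k a b c d) →
        B ⊆ vertexBoundary (slabRect k a b c d) →
        C ⊆ vertexBoundary (slabRect k a b c d) →
        D ⊆ vertexBoundary (slabRect k a b c d) →
        Disjoint (slabProj '' A) (slabProj '' B) →
        Disjoint (slabProj '' A) (slabProj '' C) →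
        Disjoint (slabProj '' A) (slabProj '' D) →
        Disjoint (slabProj '' B) (slabProj '' C) →
        Disjoint (slabProj '' B) (slabProj '' D) →
        Disjoint (slabProj '' C) (slabProj '' D) →
        (∀ (x y u v : Slab k) (w₁ : (slabGraph k).Walk x y) (w₂ : (slabGraph k).Walk u v),
          IsPathFromToIn A B (slabRect k a b c d) w₁ →
          IsPathFromToIn C D (slabRect k a b c d) w₂ →
          (projTrace w₁ ∩ projTrace w₂).Nonempty) →
        ∀ p : I, ε ≤ (p : ℝ) → (p : ℝ) ≤ 1 - ε →
          h₀ (min (connProb p A B (slabRect k a b c d)) (connProb p C D (slabRect k a b c d)))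
            ≤ connProb p C A (slabRect k a b c d) := by
  obtain ⟨h, hh, hle⟩ := Gluing.exists_increasingHomeo_of_estimates
    (K := (2 / ε) ^ ((k + 1) * (9 * (k + 1)))) (by positivity)
  refine ⟨h, hh, ?_⟩
  intro a b c d _ _ A B C D _ _ _ _ _ _ _ _ _ hCD hcross p hp hp'
  obtain ⟨h1, h2⟩ := Gluing.connProb_estimates hε hp hp' hCD hcross rfl
  exact hle _ _ _ h1 h2
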